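/- **Conventions.** All posets are finite and have a least element $\hat 0$. For a subset $T$ of a poset $\mathcal P$, $\bigvee T$ (resp. $\bigwedge T$) denotes the set of minimal upper bounds (resp. maximal lower bounds) of $T$; write $x\vee y=\bigvee\{x,y\}$ and $x\wedge y=\bigwedge\{x,y\}$. $\mathcal P$ is a lattice if $|x\vee y|=|x\wedge y|=1$ for all $x,y$; a lattice is *geometric* if for all $x,y$: $y$ covers $x$ if and only if $y=x\vee a$ for some atom $a\not\le x$. $\mathcal P$ is *locally geometric* if $\mathcal P_{\le x}$ is a geometric lattice for every $x\in\mathcal P$. Let $A(\mathcal P)$ be the set of atoms, $\operatorname{rk}(x)$ the length of the maximal chains with greatest element $x$, $\operatorname{rk}(\mathcal P)=\max_x\operatorname{rk}(x)$, and $\chi_{\mathcal P}(t)=\sum_{x}\mu(\hat 0,x)\,t^{\operatorname{rk}(\mathcal P)-\operatorname{rk}(x)}$ the characteristic polynomial, $\mu$ being the Möbius function. $\mathcal P$ is *factorable* if all complex roots of $\chi_{\mathcal P}$ are positive integers; then $\exp(\mathcal P)$ is the multiset of these roots. For $B\subseteq A(\mathcal P)$ let $\mathcal P(B)=\bigcup_{T\subseteq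 B}\bigvee T$, with the induced order; for an atom $a$ put $\mathcal P'=\mathcal P(A(\mathcal P)\setminus\{a\})$ and $\mathcal P''=\mathcal P_{\ge a}$. The class $\mathbf{IP}$ of *inductive* posets is the smallest class of locally geometric posets that contains the one-element posets and contains $\mathcal P$ whenever there is an atom $a$ with $\mathcal P',\mathcal P''\in\mathbf{IP}$ and $\chi_{\mathcal P''}\mid\chi_{\mathcal P'}$. The class $\mathbf{DP}$ of *divisional* posets is the smallest class of locally geometric posets that contains the one-element posets and contains $\mathcal P$ whenever there is an atom $a$ with $\mathcal P''\in\mathbf{DP}$ and $\chi_{\mathcal P''}\mid\chi_{\mathcal P}$. An element $x$ of a geometric lattice $L$ is *modular* if $x\wedge(y\vee z)=(x\wedge y)\vee z$ for all $z\le x$ and $y\in L$. A *TM-ideal* of a locally geometric poset $\mathcal P$ is a downward-closed subset $\mathcal Q$ such that all maximal elements of $\mathcal Q$ have the same rank; $\bigvee T\subseteq\mathcal Q$ for every $T\subseteq\mathcal Q$; $|a\vee y|=1$ for all $y\in\mathcal Q$ and $a\in A(\mathcal P)\setminus A(\mathcal Q)$; and for every maximal $x\in\mathcal P$ some maximal element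 $y$ of $\mathcal Q$ satisfies $y\le x$ and is modular in $\mathcal P_{\le x}$. $\mathcal P$ is *strictly supersolvable* if it is locally geometric and has a chain (a TM-chain) $\{\hat 0\}=\mathcal Q_0\subsetneq\mathcal Q_1\subsetneq\dots\subsetneq\mathcal Q_r=\mathcal P$ with $\operatorname{rk}(\mathcal Q_i)=i$ for $0\le i\le r$ and $\mathcal Q_i$ a TM-ideal of $\mathcal Q_{i+1}$ for $0\le i<r$. **Theorem.** 1. Every strictly supersolvable poset is inductive. 2. Let $\mathcal P$ be a locally geometric poset and $\mathcal Q$ a TM-ideal of $\mathcal P$ with $\operatorname{rk}(\mathcal Q)=\operatorname{rk}(\mathcal P)-1$. Then: - for every $a\in A(\mathcal P)\setminus A(\mathcal Q)$ there is a poset isomorphism $\mathcal Q\simeq\mathcal P_{\ge a}$; - if $\mathcal Q\in\mathbf{IP}$, then $\mathcal P\in\mathbf{IP}$; if $\mathcal Q\in\mathbf{DP}$, then $\mathcal P\in\mathbf{DP}$; in either case $\mathcal Q$ and $\mathcal P$ are factorable and $\exp(\mathcal P)=\exp(\mathcal Q)\cup\{|A(\mathcal P)\setminus A(\mathcal Q)|\}$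 as multisets. -/

import Mathlib

/-!
Finite posets with a least element are represented by types carrying
`[PartialOrder P] [OrderBot P] [Finite P]`.
-/

noncomputable section

universe u

namespace LGPoset

section Basic

variable {P : Type u} [PartialOrder P]

/-- The join `⋁ T`: the set of all minimal upper bounds of `T`. -/
def joinSet (T : Set P) : Set P := {b | Minimal (· ∈ upperBounds T) b}

/-- The meet `⋀ T`: the set of all maximal lower bounds of `T`. -/
def meetSet (T : Set P) : Set P := {b | Maximal (· ∈ lowerBounds T) b}

/-- The rank of an element: the length of a longest chain with greatest element `x`. In a ranked
poset this is the common length of all maximal chains among those with greatest element `x`;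
locally geometric posets (see below) are always ranked, because geometric lattices are graded. -/
def rk (x : P) : ℕ := (Order.height x).toNat

variable (P) in
/-- The rank of a (finite, nonempty) poset: the maximum of the ranks of its elements. -/
def rank : ℕ := ⨆ x : P, rk x

variable (P) in
/-- A lattice: any two elements have exactly one minimal upper bound and exactly one maximal
lower bound. -/
def IsLatticePoset : Prop :=
  ∀ x y : P, (∃! z, z ∈ joinSet {x, y}) ∧ (∃! z, z ∈ meetSet {x, y})

variable (P) in
/-- A geometric lattice: a lattice in which `y` covers `x` if and only if `y = x ∨ a` for some
atom `a` not below `x`. -/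
def IsGeometricLattice [OrderBot P] : Prop :=
  IsLatticePoset P ∧
    ∀ x y : P, x ⋖ y ↔ ∃ a : P, IsAtom a ∧ ¬ a ≤ x ∧ y ∈ joinSet {x, a}

variable (P) in
/-- A locally geometric poset: every principal order ideal `P_{≤ x}` is a geometric lattice. -/
def IsLocallyGeometric [OrderBot P] : Prop :=
  ∀ x : P, IsGeometricLattice (Set.Iic x)

/-- A modular element `x` of a lattice: `x ∧ (y ∨ z) = (x ∧ y) ∨ z` for all `z ≤ x` and all `y`.
(In a lattice `joinSet {y, z}` and `meetSet {x, y}` are singletons: `u = y ∨ z`, `v = x ∧ y`.) -/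
def IsModularElement (x : P) : Prop :=
  ∀ z y : P, z ≤ x → ∀ u ∈ joinSet {y, z}, ∀ v ∈ meetSet {x, y},
    meetSet {x, u} = joinSet {v, z}

variable (P) in
/-- A pure poset: all maximal elements have the same rank. -/
def IsPure : Prop := ∀ x y : P, IsMax x → IsMax y → rk x = rk y

end Basic

section Subposets

variable {P : Type u} [PartialOrder P]

/-- The subposet `P(B)` generated by a set `B` of atoms: all possible joins of subsets of `B`
(the empty subset contributes the least element). It carries the order induced from `P`. -/
def generated (B : Set P) : Set P := {x | ∃ T ⊆ B, x ∈ joinSet T}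

variable [OrderBot P]

theorem bot_mem_generated (B : Set P) : (⊥ : P) ∈ generated B :=
  ⟨∅, Set.empty_subset B, by simp [joinSet, Minimal]⟩

instance (B : Set P) : OrderBot (generated B) where
  bot := ⟨⊥, bot_mem_generated B⟩
  bot_le x := (bot_le : (⊥ : P) ≤ x.1)

/-- The deletion `P' = P(A ∖ {a})`, where `A` is the set of atoms of `P`. -/
abbrev Deletion (a : P) : Type u := generated ({b : P | IsAtom b} \ {a})

/-- The restriction `P'' = P_{≥ a}`. -/
abbrev Restriction (a : P) : Type u := Set.Ici a

variable (P) in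
/-- A nonempty order ideal: a downward-closed subset containing the least element. (Every
join-closed order ideal contains the least element, which is the join of the empty set.) -/
structure OrderIdeal where
  carrier : Set P
  lower : IsLowerSet carrier
  bot_mem : ⊥ ∈ carrier

namespace OrderIdeal

/-- An order ideal regarded as a poset with the induced order. -/
abbrev Elem (Q : OrderIdeal P) : Type u := {x : P // x ∈ Q.carrier}

instance (Q : OrderIdeal P) : OrderBot Q.Elem where
  bot := ⟨⊥, Q.bot_mem⟩
  bot_le x := (bot_le : (⊥ : P) ≤ x.1)

/-- For order ideals `Q`, `R` of `P` with `Q ⊆ R`: the ideal `Q`, regarded as an order ideal of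
the poset `R`. -/
def within (Q R : OrderIdeal P) : OrderIdeal R.Elem where
  carrier := {x | x.1 ∈ Q.carrier}
  lower := fun _ _ h hx => Q.lower h hx
  bot_mem := Q.bot_mem

/-- The set `A(P) ∖ A(Q)`. Since `Q` is downward closed, its atoms are the atoms of `P` that lie
in `Q`. -/
def outerAtoms (Q : OrderIdeal P) : Set P := {a | IsAtom a ∧ a ∉ Q.carrier}

/-- A TM-ideal `Q` of a (locally geometric) poset `P`. -/
structure IsTMIdeal (Q : OrderIdeal P) : Prop where
  pure : IsPure Q.Elem
  joinClosed : ∀ T ⊆ Q.carrier, joinSet T ⊆ Q.carrier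
  existsUnique_join : ∀ y ∈ Q.carrier, ∀ a ∈ Q.outerAtoms, ∃! b, b ∈ joinSet {a, y}
  exists_modular : ∀ x : P, IsMax x →
    ∃ (y : P) (hyx : y ≤ x), Maximal (· ∈ Q.carrier) y ∧
      IsModularElement (⟨y, hyx⟩ : Set.Iic x)

end OrderIdeal

variable (P) in
/-- A strictly supersolvable poset: a locally geometric poset with a TM-chain
`{⊥} = Q₀ ⊊ Q₁ ⊊ ⋯ ⊊ Q_r = P`, where `Qᵢ` is a TM-ideal of `Qᵢ₊₁` and `rk Qᵢ = i`. -/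
def IsStrictlySupersolvable : Prop :=
  IsLocallyGeometric P ∧
    ∃ (r : ℕ) (Q : ℕ → OrderIdeal P),
      (Q 0).carrier = {⊥} ∧ (Q r).carrier = Set.univ ∧
      (∀ i < r, (Q i).carrier ⊂ (Q (i + 1)).carrier ∧
        ((Q i).within (Q (i + 1))).IsTMIdeal) ∧
      ∀ i ≤ r, rank (Q i).Elem = i

end Subposets

section CharPoly

open Polynomial

open scoped Classical in
/-- The Möbius function of a finite poset. -/
def mobius {P : Type u} [PartialOrder P] [Finite P] (x y : P) : ℤ :=
  letI : Fintype P := Fintype.ofFinite P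
  letI : LocallyFiniteOrder P := Fintype.toLocallyFiniteOrder
  IncidenceAlgebra.mu ℤ x y

/-- The characteristic polynomial `∑ₓ μ(⊥, x) t ^ (rk P - rk x)`. -/
def charPoly (P : Type u) [PartialOrder P] [OrderBot P] [Finite P] : ℤ[X] :=
  letI : Fintype P := Fintype.ofFinite P
  ∑ x : P, C (mobius ⊥ x) * X ^ (rank P - rk x)

/-- A factorable poset: every (complex) root of the characteristic polynomial is a positive
integer. -/
def IsFactorable (P : Type u) [PartialOrder P] [OrderBot P] [Finite P] : Prop :=
  ∀ z ∈ (charPoly P).aroots ℂ, ∃ d : ℕ, 0 < d ∧ z = d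

/-- The exponents of a factorable poset: the multiset of roots of its characteristic polynomial
(for a factorable poset all complex roots are integers). -/
def exponents (P : Type u) [PartialOrder P] [OrderBot P] [Finite P] : Multiset ℤ :=
  (charPoly P).roots

end CharPoly

/-- The class of inductive posets: the smallest class of locally geometric posets that contains the
one-element posets and contains `P` as soon as, for some atom `a`, it contains `P''` and `P'` and
the characteristic polynomial of `P''` divides that of `P'`. -/
inductive IsInductivePoset : ∀ (P : Type u) [PartialOrder P] [OrderBot P] [Finite P], Prop
  | trivial (P : Type u) [PartialOrder P] [OrderBot P] [Finite P] (h : Subsingleton P) :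
      IsInductivePoset P
  | addition (P : Type u) [PartialOrder P] [OrderBot P] [Finite P]
      (hP : IsLocallyGeometric P) (a : P) (ha : IsAtom a)
      (hres : IsInductivePoset (Restriction a)) (hdel : IsInductivePoset (Deletion a))
      (hdvd : charPoly (Restriction a) ∣ charPoly (Deletion a)) :
      IsInductivePoset P

/-- The class of divisional posets: the smallest class of locally geometric posets that contains
the one-element posets and contains `P` as soon as, for some atom `a`, it contains `P''` and the
characteristic polynomial of `P''` divides that of `P`. -/
inductive IsDivisionalPoset : ∀ (P : Type u) [PartialOrder P] [OrderBot P] [Finite P], Prop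
  | trivial (P : Type u) [PartialOrder P] [OrderBot P] [Finite P] (h : Subsingleton P) :
      IsDivisionalPoset P
  | division (P : Type u) [PartialOrder P] [OrderBot P] [Finite P]
      (hP : IsLocallyGeometric P) (a : P) (ha : IsAtom a)
      (hres : IsDivisionalPoset (Restriction a))
      (hdvd : charPoly (Restriction a) ∣ charPoly P) :
      IsDivisionalPoset P

end LGPoset

end

/-!
# Strictly supersolvable posets are inductive

Let `Q` be a TM-ideal of a locally geometric poset `P` with `rank P = rank Q + 1`. Above an outer
atom `a` every maximal element `m` of `P` covers the greatest element `y` of `Q` below `m`, and `y`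
is modular in `P_{≤ m}`. The modular law and a comparison of ranks then show that `x ↦ x ∧ y` inverts
`q ↦ a ∨ q`: all joins `a ∨ q` with `q ∈ Q` are least upper bounds, `q` is the greatest element of
`Q` below `a ∨ q`, and every `x ≥ a` is such a join. This is recorded in `IsModularCorankOne`, and
only this survives in the rest of the argument (`OrderIdeal.IsTMIdeal.isModularCorankOne`). It says
that `Q ≃ P_{≥ a}`, and that outside `Q` the poset is covered by one copy `a ∨ Q` of `Q` for each
outer atom `a`.

Correspondingly `μ_P` is `μ_Q` minus the sum of its transports to the copies: this function satisfies
the recursion which determines `μ_P`. Hence `χ_P = (t - n) χ_Q`, where `n` is the number of outer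
atoms (`IsModularCorankOne.rank_and_charPoly`). As the restriction at an outer atom is `Q`, this gives
the statement on divisional posets. Deleting an outer atom preserves the structure and decreases `n`,
so the statement on inductive posets follows by induction on `n`
(`IsModularCorankOne.isInductivePoset`), and strictly supersolvable posets are reached by climbing a
TM-chain.

For the factorability of `Q`, which is pure, one shows that pure divisional posets are factorable:
restrictions of pure posets are pure and of rank one less, so each division step contributes a single
integral root, which is positive because the Möbius function of a geometric lattice alternates in
sign (`mobius_sign`, from Weisner's theorem). Pure inductive posets are divisional by the
deletion–restriction formula (`charPoly_eq_deletion_sub_restriction`).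
-/

noncomputable section

universe u

namespace LGPoset

open Polynomial

/-! ### Rank functions -/

section Rank

variable {P : Type u} [PartialOrder P]

theorem exists_joinSet_le [Finite P] {T : Set P} {w : P} (hw : w ∈ upperBounds T) :
    ∃ z ∈ joinSet T, z ≤ w := by
  obtain ⟨z, hz, hm⟩ := (Set.toFinite (upperBounds T)).exists_le_minimal hw
  exact ⟨z, hm, hz⟩

theorem rk_le_rank [Finite P] (x : P) : rk x ≤ rank P :=
  le_ciSup (Set.finite_range (fun x : P => rk x)).bddAbove x

theorem rk_orderIso {P' : Type*} [PartialOrder P'] (e : P ≃o P') (x : P) : rk (e x) = rk x := by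
  simp [rk, Order.height_orderIso]

theorem rank_orderIso {P' : Type*} [PartialOrder P'] (e : P ≃o P') : rank P' = rank P := by
  unfold rank
  rw [← e.surjective.iSup_comp]
  simp [rk_orderIso]

theorem rk_coe_of_isLowerSet {S : Set P} (hS : IsLowerSet S) (x : {x // x ∈ S}) :
    rk x.1 = rk x := by
  unfold rk
  rw [Order.height_eq_of_strictMono (Subtype.val : {x // x ∈ S} → P) (fun _ _ h => h) _ x]
  intro a b hb
  exact ⟨⟨b, hS hb.le a.2⟩, hb, rfl⟩

theorem coe_covBy_coe_iff {S : Set P} (hS : S.OrdConnected) {x y : {x // x ∈ S}} :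
    x.1 ⋖ y.1 ↔ x ⋖ y :=
  Set.OrdConnected.apply_covBy_apply_iff (OrderEmbedding.subtype (· ∈ S)) (by simpa using hS)

theorem isLUB_of_existsUnique [Finite P] {T : Set P} (h : ∃! z, z ∈ joinSet T) {z : P}
    (hz : z ∈ joinSet T) : IsLUB T z := by
  refine ⟨hz.1, fun w hw => ?_⟩
  obtain ⟨z', hz', hle⟩ := exists_joinSet_le hw
  exact (h.unique hz hz') ▸ hle

theorem mem_joinSet_of_isLUB {T : Set P} {z : P} (h : IsLUB T z) : z ∈ joinSet T :=
  ⟨h.1, fun _ hw _ => h.2 hw⟩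

variable [OrderBot P]

theorem eq_of_covBy_of_lt_of_le {P : Type u} [PartialOrder P] {x y z : P} (h : x ⋖ y) (h1 : x < z)
    (h2 : z ≤ y) : z = y :=
  (h.eq_or_eq h1.le h2).resolve_left h1.ne'

/-- A function which vanishes at `⊥` and increases by one along covers is the rank function. -/
theorem height_eq_of_covBy [Finite P] {f : P → ℕ} (h0 : f ⊥ = 0)
    (hc : ∀ x y, x ⋖ y → f y = f x + 1) (x : P) : Order.height x = f x := by
  have mono : ∀ y x : P, x < y → f x < f y := by
    intro y
    induction y using WellFoundedLT.induction with
    | ind y ih =>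
      intro x hxy
      obtain ⟨z, hxz, hzy⟩ := exists_le_covBy_of_lt hxy
      have h1 := hc _ _ hzy
      rcases hxz.eq_or_lt with rfl | h
      · omega
      · have := ih z hzy.lt x h
        omega
  induction x using WellFoundedLT.induction with
  | ind x ih =>
    apply le_antisymm
    · rw [Order.height_le_coe_iff]
      intro y hy
      rw [ih y hy]
      exact_mod_cast mono _ _ hy
    · rcases (bot_le (a := x)).eq_or_lt with h | h
      · simp [← h, h0]
      · obtain ⟨z, -, hz⟩ := exists_le_covBy_of_lt h
        rw [hc z x hz]
        push_cast
        rw [← ih z hz.lt]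
        exact Order.height_add_one_le hz.lt

theorem rk_eq_of_covBy [Finite P] {f : P → ℕ} (h0 : f ⊥ = 0)
    (hc : ∀ x y, x ⋖ y → f y = f x + 1) (x : P) : rk x = f x := by
  simp [rk, height_eq_of_covBy h0 hc x]

@[simp] theorem rk_bot : rk (⊥ : P) = 0 := by simp [rk]

theorem exists_rk_eq_rank [Finite P] : ∃ x : P, rk x = rank P :=
  exists_eq_ciSup_of_finite

theorem rank_le [Finite P] {n : ℕ} (h : ∀ x : P, rk x ≤ n) : rank P ≤ n := ciSup_le h

end Rank

/-! ### Locally geometric posets -/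

/-- `z` is the join of `x` and `y` in the principal ideal of `m`. -/
structure IsJoinBelow {P : Type u} [PartialOrder P] (m x y z : P) : Prop where
  le : z ≤ m
  left : x ≤ z
  right : y ≤ z
  least : ∀ w ≤ m, x ≤ w → y ≤ w → z ≤ w

variable (P : Type u) [PartialOrder P]

/-- An order-theoretic form of local geometricity which does not mention subtypes: joins exist
inside every principal ideal, elements are told apart by the atoms below them, and adjoining an atom
produces a cover. -/
structure HasLocalGeometry [OrderBot P] : Prop where
  exists_join : ∀ m x y : P, x ≤ m → y ≤ m → ∃ z, IsJoinBelow m x y z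
  exists_atom : ∀ x y : P, x < y → ∃ a, IsAtom a ∧ a ≤ y ∧ ¬ a ≤ x
  covBy : ∀ x a y : P, IsAtom a → ¬ a ≤ x → y ∈ joinSet {x, a} → x ⋖ y

variable {P}

theorem IsJoinBelow.mem_joinSet {m x y z : P} (h : IsJoinBelow m x y z) : z ∈ joinSet {x, y} := by
  refine ⟨by simp [upperBounds, h.left, h.right], fun w hw hwz => ?_⟩
  simp only [upperBounds_insert, upperBounds_singleton, Set.mem_inter_iff, Set.mem_Ici] at hw
  exact h.least w (hwz.trans h.le) hw.1 hw.2

theorem IsJoinBelow.symm {m x y z : P} (h : IsJoinBelow m x y z) : IsJoinBelow m y x z :=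
  ⟨h.le, h.right, h.left, fun w hw h1 h2 => h.least w hw h2 h1⟩

theorem isLUB_pair_iff {x y z : P} :
    IsLUB {x, y} z ↔ x ≤ z ∧ y ≤ z ∧ ∀ w, x ≤ w → y ≤ w → z ≤ w := by
  simp [IsLUB, IsLeast, upperBounds, lowerBounds, and_assoc]

/-- A finite poset with a least element and all binary joins is a lattice: the meet of two elements
is a maximal lower bound, which absorbs every other lower bound through their join. -/
theorem isLatticePoset_of_exists_isLUB [OrderBot P] [Finite P]
    (h : ∀ x y : P, ∃ z, IsLUB {x, y} z) : IsLatticePoset P := by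
  intro x y
  constructor
  · obtain ⟨z, hz⟩ := h x y
    exact ⟨z, mem_joinSet_of_isLUB hz, fun w hw => le_antisymm (hw.2 hz.1 (hz.2 hw.1)) (hz.2 hw.1)⟩
  · obtain ⟨z, -, hz⟩ := Finite.exists_le_maximal (p := (· ∈ lowerBounds {x, y})) (a := (⊥ : P))
      (by simp [lowerBounds])
    refine ⟨z, hz, fun w hw => ?_⟩
    have key : ∀ v w : P, Maximal (· ∈ lowerBounds {x, y}) v → w ∈ lowerBounds {x, y} →
        w ≤ v := by
      intro v w hv hw
      obtain ⟨s, hs⟩ := h v w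
      rw [isLUB_pair_iff] at hs
      have h1 : s ∈ lowerBounds {x, y} := by
        intro t ht
        exact hs.2.2 t (hv.1 ht) (hw ht)
      exact hs.2.1.trans (hv.2 h1 hs.1)
    exact le_antisymm (key z w hz hw.1) (key w z hw hz.1)

theorem IsAtom.coe_Iic [OrderBot P] {m : P} {a : Set.Iic m} : IsAtom a ↔ IsAtom a.1 := by
  rw [← bot_covBy_iff, ← bot_covBy_iff]
  exact (coe_covBy_coe_iff (P := P) Set.ordConnected_Iic).symm

theorem mem_joinSet_coe_Iic {m : P} {x y z : Set.Iic m} :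
    z ∈ joinSet {x, y} ↔ z.1 ∈ joinSet {x.1, y.1} := by
  constructor
  · intro h
    refine ⟨?_, fun w hw hwz => ?_⟩
    · have := h.1
      simpa [upperBounds] using this
    · exact h.2 (y := ⟨w, hwz.trans z.2⟩)
        (by simpa [upperBounds, ← Subtype.coe_le_coe] using hw) hwz
  · intro h
    refine ⟨?_, fun w hw hwz => ?_⟩
    · have := h.1
      simpa [upperBounds, ← Subtype.coe_le_coe] using this
    · exact h.2 (y := w.1) (by simpa [upperBounds, ← Subtype.coe_le_coe] using hw) hwz

variable [OrderBot P]

namespace HasLocalGeometry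

variable (hP : HasLocalGeometry P)
include hP

theorem covBy_of_isJoinBelow {m x a y : P} (ha : IsAtom a) (hax : ¬ a ≤ x)
    (h : IsJoinBelow m x a y) : x ⋖ y := hP.covBy x a y ha hax h.mem_joinSet

theorem exists_atom_isJoinBelow {x y : P} (h : x ⋖ y) :
    ∃ a, IsAtom a ∧ ¬ a ≤ x ∧ IsJoinBelow y x a y := by
  obtain ⟨a, ha, hay, hax⟩ := hP.exists_atom _ _ h.lt
  obtain ⟨z, hz⟩ := hP.exists_join y x a h.le hay
  have hzy : z = y := eq_of_covBy_of_lt_of_le h (hz.left.lt_of_ne fun h => hax (h ▸ hz.right)) hz.le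
  exact ⟨a, ha, hax, hzy ▸ hz⟩

theorem of_orderIdeal (Q : OrderIdeal P) : HasLocalGeometry Q.Elem where
  exists_join m x y hx hy := by
    obtain ⟨z, hz⟩ := hP.exists_join m.1 x.1 y.1 hx hy
    exact ⟨⟨z, Q.lower hz.le m.2⟩, hz.le, hz.left, hz.right, fun w => hz.least w.1⟩
  exists_atom x y h := by
    obtain ⟨a, ha, hay, hax⟩ := hP.exists_atom x.1 y.1 h
    refine ⟨⟨a, Q.lower hay y.2⟩, ?_, hay, hax⟩
    rw [← bot_covBy_iff] at ha ⊢
    exact (coe_covBy_coe_iff Q.lower.ordConnected).1 ha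
  covBy x a y ha hax hy := by
    rw [← bot_covBy_iff] at ha
    have ha' := (coe_covBy_coe_iff Q.lower.ordConnected).2 ha
    rw [← coe_covBy_coe_iff Q.lower.ordConnected]
    refine hP.covBy x.1 a.1 y.1 (bot_covBy_iff.1 ha') hax ⟨?_, fun w hw hwy => ?_⟩
    · have := hy.1
      simpa [upperBounds, ← Subtype.coe_le_coe] using this
    · exact hy.2 (y := ⟨w, Q.lower hwy y.2⟩)
        (by simpa [upperBounds, ← Subtype.coe_le_coe] using hw) hwy

end HasLocalGeometry

variable [Finite P]

theorem IsLocallyGeometric.hasLocalGeometry (hP : IsLocallyGeometric P) : HasLocalGeometry P where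
  exists_join m x y hx hy := by
    have h := ((hP m).1 ⟨x, hx⟩ ⟨y, hy⟩).1
    obtain ⟨z, hz, -⟩ := id h
    have hl := isLUB_pair_iff.1 (isLUB_of_existsUnique h hz)
    exact ⟨z.1, z.2, hl.1, hl.2.1, fun w hw h1 h2 => hl.2.2 ⟨w, hw⟩ h1 h2⟩
  exists_atom x y hxy := by
    obtain ⟨v, hv, -⟩ := exists_covBy_le_of_lt
      (show (⟨x, hxy.le⟩ : Set.Iic y) < ⟨y, le_rfl⟩ from hxy)
    obtain ⟨a, ha, hax, -⟩ := ((hP y).2 _ _).1 hv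
    exact ⟨a.1, IsAtom.coe_Iic.1 ha, a.2, hax⟩
  covBy x a y ha hax hy := by
    have h1 : x ≤ y := hy.1 (by simp)
    have h2 : a ≤ y := hy.1 (by simp)
    have := ((hP y).2 ⟨x, h1⟩ ⟨y, le_rfl⟩).2
      ⟨⟨a, h2⟩, IsAtom.coe_Iic.2 ha, hax, mem_joinSet_coe_Iic.2 hy⟩
    exact (coe_covBy_coe_iff (P := P) Set.ordConnected_Iic).2 this

namespace HasLocalGeometry

variable (hP : HasLocalGeometry P)
include hP

theorem isLocallyGeometric : IsLocallyGeometric P := by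
  intro m
  refine ⟨isLatticePoset_of_exists_isLUB fun x y => ?_, fun x y => ⟨fun h => ?_, ?_⟩⟩
  · obtain ⟨z, hz⟩ := hP.exists_join m x y x.2 y.2
    exact ⟨⟨z, hz.le⟩, isLUB_pair_iff.2 ⟨hz.left, hz.right, fun w => hz.least w.1 w.2⟩⟩
  · have h' : x.1 ⋖ y.1 := (coe_covBy_coe_iff (P := P) Set.ordConnected_Iic).2 h
    obtain ⟨a, ha, hay, hax⟩ := hP.exists_atom _ _ h'.lt
    obtain ⟨z, hz⟩ := hP.exists_join y x a h'.le hay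
    have hzy : z = y.1 := eq_of_covBy_of_lt_of_le h' (hz.left.lt_of_ne fun h => hax (h ▸ hz.right)) hz.le
    refine ⟨⟨a, hay.trans y.2⟩, IsAtom.coe_Iic.2 ha, hax, mem_joinSet_coe_Iic.2 ?_⟩
    exact hzy ▸ hz.mem_joinSet
  · rintro ⟨a, ha, hax, hy⟩
    exact (coe_covBy_coe_iff (P := P) Set.ordConnected_Iic).1
      (hP.covBy _ _ _ (IsAtom.coe_Iic.1 ha) hax (mem_joinSet_coe_Iic.1 hy))

/-- Bounded pairs have greatest lower bounds. -/
theorem exists_isGLB {m x y : P} (hx : x ≤ m) (hy : y ≤ m) :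
    ∃ z, z ≤ x ∧ z ≤ y ∧ ∀ w, w ≤ x → w ≤ y → w ≤ z := by
  obtain ⟨z, -, hz⟩ := Finite.exists_le_maximal (p := fun z => z ≤ x ∧ z ≤ y) (a := (⊥ : P))
    (by simp)
  refine ⟨z, hz.1.1, hz.1.2, fun w h1 h2 => ?_⟩
  obtain ⟨s, hs⟩ := hP.exists_join m z w (hz.1.1.trans hx) (h1.trans hx)
  exact hs.right.trans (hz.2 ⟨hs.least _ hx hz.1.1 h1, hs.least _ hy hz.1.2 h2⟩ hs.left)

/-- The join formed in a principal ideal does not depend on the ideal. -/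
theorem le_of_isJoinBelow {m n x y z w : P} (h : IsJoinBelow m x y z) (hz : z ≤ n) (hw : w ≤ n)
    (hxw : x ≤ w) (hyw : y ≤ w) : z ≤ w := by
  obtain ⟨t, htz, htw, ht⟩ := hP.exists_isGLB hz hw
  exact (h.least t (htz.trans h.le) (ht _ h.left hxw) (ht _ h.right hyw)).trans htw

/-- Inside a principal ideal the order is determined by the atoms. -/
theorem le_of_atoms_le {m x y : P} (hx : x ≤ m) (hy : y ≤ m)
    (h : ∀ a, IsAtom a → a ≤ x → a ≤ y) : x ≤ y := by
  obtain ⟨z, hzx, hzy, hz⟩ := hP.exists_isGLB hx hy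
  rcases hzx.eq_or_lt with rfl | hlt
  · exact hzy
  · obtain ⟨a, ha, hax, haz⟩ := hP.exists_atom _ _ hlt
    exact absurd (hz a hax (h a ha hax)) haz

/-- Upper semimodularity. -/
theorem exists_covBy_covBy {m u v w : P} (hv : u ⋖ v) (hw : u ⋖ w) (hne : v ≠ w)
    (hvm : v ≤ m) (hwm : w ≤ m) : ∃ z ≤ m, v ⋖ z ∧ w ⋖ z := by
  obtain ⟨z, hz⟩ := hP.exists_join m v w hvm hwm
  have key : ∀ {v w : P}, u ⋖ v → u ⋖ w → v ≠ w → IsJoinBelow m v w z → v ⋖ z := by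
    intro v w hv hw hne hz
    obtain ⟨b, hb, hbu, hbj⟩ := hP.exists_atom_isJoinBelow hw
    have hbv : ¬ b ≤ v := by
      intro h
      obtain ⟨t, ht1, ht2, ht⟩ := hP.exists_isGLB (hz.left.trans hz.le) (hz.right.trans hz.le)
      have htu : u = t := by
        refine (ht _ hv.le hw.le).eq_or_lt.resolve_right fun hlt => hne ?_
        rw [← eq_of_covBy_of_lt_of_le hv hlt ht1, ← eq_of_covBy_of_lt_of_le hw hlt ht2]
      exact hbu (htu ▸ ht b h hbj.right)
    refine hP.covBy_of_isJoinBelow (m := m) hb hbv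
      ⟨hz.le, hz.left, hbj.right.trans hz.right, fun s hs h1 h2 => ?_⟩
    refine hz.least s hs h1 ?_
    exact hP.le_of_isJoinBelow hbj (hz.right.trans hz.le) hs (hv.le.trans h1) h2
  exact ⟨z, hz.le, key hv hw hne hz, key hw hv hne.symm hz.symm⟩

end HasLocalGeometry

/-! ### Gradedness -/

/-- `SatChain n x y`: there is a saturated chain of length `n` from `x` to `y`. -/
inductive SatChain {P : Type u} [PartialOrder P] : ℕ → P → P → Prop
  | nil (x : P) : SatChain 0 x x
  | cons {n : ℕ} {x y z : P} : x ⋖ y → SatChain n y z → SatChain (n + 1) x z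

namespace SatChain

theorem le {P : Type u} [PartialOrder P] {n : ℕ} {x y : P} (h : SatChain n x y) : x ≤ y := by
  induction h with
  | nil => exact le_rfl
  | cons h _ ih => exact h.le.trans ih

theorem snoc {P : Type u} [PartialOrder P] {n : ℕ} {x y z : P} (h : SatChain n x y)
    (hz : y ⋖ z) : SatChain (n + 1) x z := by
  induction h with
  | nil => exact .cons hz (.nil _)
  | cons h _ ih => exact .cons h (ih hz)

theorem exists_of_le {P : Type u} [PartialOrder P] [Finite P] {x y : P} (h : x ≤ y) :
    ∃ n, SatChain n x y := by
  induction x using WellFoundedGT.induction with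
  | ind x ih =>
    rcases h.eq_or_lt with rfl | h
    · exact ⟨0, .nil _⟩
    · obtain ⟨z, hz, hzy⟩ := exists_covBy_le_of_lt h
      obtain ⟨n, hn⟩ := ih z hz.lt hzy
      exact ⟨n + 1, .cons hz hn⟩

/-- The Jordan–Dedekind chain condition. -/
theorem length_unique (hP : HasLocalGeometry P) {n k : ℕ} {x y : P} (hn : SatChain n x y)
    (hk : SatChain k x y) : n = k := by
  induction n generalizing x k with
  | zero =>
    cases hn
    cases hk with
    | nil => rfl
    | cons h h' => exact absurd h'.le h.lt.not_ge
  | succ n ih =>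
    cases hn with
    | @cons _ _ v _ h h' =>
    cases hk with
    | nil => exact absurd h'.le h.lt.not_ge
    | @cons k _ w _ g g' =>
      congr 1
      by_cases hvw : v = w
      · subst hvw
        exact ih h' g'
      · obtain ⟨z, hzy, hvz, hwz⟩ := hP.exists_covBy_covBy h g hvw h'.le g'.le
        obtain ⟨j, hj⟩ := exists_of_le hzy
        obtain rfl := ih h' (.cons hvz hj)
        exact ih (.cons hwz hj) g'

end SatChain

namespace HasLocalGeometry

variable (hP : HasLocalGeometry P)
include hP

/-- The rank, defined by longest chains, is the length of any saturated chain from `⊥`. -/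
theorem satChain_rk (x : P) : SatChain (rk x) ⊥ x := by
  choose f hf using fun x : P => SatChain.exists_of_le (bot_le (a := x))
  have : ∀ x, rk x = f x := rk_eq_of_covBy ((hf ⊥).length_unique hP (.nil _))
    fun x y h => (hf y).length_unique hP ((hf x).snoc h)
  rw [this]
  exact hf x

theorem rk_of_covBy {x y : P} (h : x ⋖ y) : rk y = rk x + 1 :=
  (hP.satChain_rk y).length_unique hP ((hP.satChain_rk x).snoc h)

theorem rk_lt_of_lt {x y : P} (h : x < y) : rk x < rk y := by
  induction x using WellFoundedGT.induction with
  | ind x ih =>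
    obtain ⟨z, hz, hzy⟩ := exists_covBy_le_of_lt h
    have := hP.rk_of_covBy hz
    rcases hzy.eq_or_lt with rfl | h'
    · omega
    · have := ih z hz.lt h'
      omega

theorem rk_mono {x y : P} (h : x ≤ y) : rk x ≤ rk y := by
  rcases h.eq_or_lt with rfl | h
  · exact le_rfl
  · exact (hP.rk_lt_of_lt h).le

theorem covBy_of_lt_of_rk {x y : P} (h : x < y) (hr : rk y ≤ rk x + 1) : x ⋖ y := by
  obtain ⟨z, hz, hzy⟩ := exists_covBy_le_of_lt h
  have := hP.rk_of_covBy hz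
  rcases hzy.eq_or_lt with rfl | h'
  · exact hz
  · have := hP.rk_lt_of_lt h'
    omega

end HasLocalGeometry

/-! ### Deletions and restrictions -/

section Generated

variable {P : Type u} [PartialOrder P]

/-- Membership in `P(B)` may be tested on the set of all elements of `B` below the given element. -/
theorem mem_generated_iff {B : Set P} {x : P} :
    x ∈ generated B ↔ ∀ w ≤ x, (∀ b ∈ B, b ≤ x → b ≤ w) → w = x := by
  constructor
  · rintro ⟨T, hT, hx⟩ w hw h
    exact le_antisymm hw (hx.2 (fun b hb => h b (hT hb) (hx.1 hb)) hw)
  · intro h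
    refine ⟨{b ∈ B | b ≤ x}, fun b hb => hb.1, fun b hb => hb.2, fun w hw hwx => ?_⟩
    exact (h w hwx fun b hb hbx => hw ⟨hb, hbx⟩).ge

theorem subset_generated {B : Set P} : B ⊆ generated B := by
  intro b hb
  rw [mem_generated_iff]
  intro w hw h
  exact le_antisymm hw (h b hb le_rfl)

theorem exists_mem_of_lt_generated {B : Set P} {x : P} {y : P}
    (hy : y ∈ generated B) (h : x < y) : ∃ b ∈ B, b ≤ y ∧ ¬ b ≤ x := by
  by_contra hcon
  push Not at hcon
  exact h.ne (mem_generated_iff.1 hy x h.le hcon)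

variable [OrderBot P]

theorem isAtom_generated_iff {B : Set P} (hB : ∀ b ∈ B, IsAtom b) {x : generated B} :
    IsAtom x ↔ x.1 ∈ B := by
  constructor
  · intro h
    have hlt : ⊥ < x.1 := h.bot_lt
    obtain ⟨b, hb, hbx, hb0⟩ := exists_mem_of_lt_generated x.2 hlt
    have := (h.le_iff (x := ⟨b, subset_generated hb⟩)).1 hbx
    rcases this with h | h
    · exact absurd (congrArg Subtype.val h) (hB b hb).1
    · exact h ▸ hb
  · intro h
    refine ⟨fun h0 => (hB _ h).1 (congrArg Subtype.val h0), fun y hy => ?_⟩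
    exact Subtype.ext ((hB _ h).2 y.1 hy)

variable [Finite P]

theorem mem_generated_of_isJoinBelow {B : Set P} {m x y z : P} (hx : x ∈ generated B)
    (hy : y ∈ generated B) (hP : HasLocalGeometry P) (h : IsJoinBelow m x y z) :
    z ∈ generated B := by
  rw [mem_generated_iff] at *
  intro w hwz hw
  have key : ∀ t ≤ z, (∀ s ≤ t, (∀ b ∈ B, b ≤ t → b ≤ s) → s = t) → t ≤ w := by
    intro t ht htB
    obtain ⟨s, hst, hsw, hs⟩ := hP.exists_isGLB ht hwz
    have : s = t := htB s hst fun b hb hbt => hs b hbt (hw b hb (hbt.trans ht))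
    exact this ▸ hsw
  exact le_antisymm hwz
    (h.least w (hwz.trans h.le) (key x h.left hx) (key y h.right hy))

/-- Every element lying above no atom outside `B` is generated by `B`. -/
theorem mem_generated_of_atoms_mem (hP : HasLocalGeometry P) {B : Set P} {x : P}
    (h : ∀ b, IsAtom b → b ≤ x → b ∈ B) : x ∈ generated B := by
  rw [mem_generated_iff]
  exact fun w hw hB => le_antisymm hw
    (hP.le_of_atoms_le le_rfl hw fun a ha hax => hB a (h a ha hax) hax)

namespace HasLocalGeometry

variable (hP : HasLocalGeometry P)
include hP

theorem coe_covBy_coe_generated {B : Set P} (hB : ∀ b ∈ B, IsAtom b) {x y : generated B} :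
    x.1 ⋖ y.1 ↔ x ⋖ y := by
  constructor
  · exact fun h => ⟨h.lt, fun c h1 h2 => h.2 (c := c.1) h1 h2⟩
  · intro h
    obtain ⟨b, hb, hby, hbx⟩ := exists_mem_of_lt_generated y.2 (show x.1 < y.1 from h.lt)
    obtain ⟨z, hz⟩ := hP.exists_join y.1 x.1 b h.lt.le hby
    have hzB := mem_generated_of_isJoinBelow x.2 (subset_generated hb) hP hz
    have hcov := hP.covBy_of_isJoinBelow (hB b hb) hbx hz
    have : (⟨z, hzB⟩ : generated B) = y := eq_of_covBy_of_lt_of_le h hcov.lt hz.le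
    exact (congrArg Subtype.val this) ▸ hcov

theorem generated {B : Set P} (hB : ∀ b ∈ B, IsAtom b) :
    HasLocalGeometry (generated B) where
  exists_join m x y hx hy := by
    obtain ⟨z, hz⟩ := hP.exists_join m.1 x.1 y.1 hx hy
    exact ⟨⟨z, mem_generated_of_isJoinBelow x.2 y.2 hP hz⟩, hz.le, hz.left, hz.right,
      fun w => hz.least w.1⟩
  exists_atom x y h := by
    obtain ⟨b, hb, hby, hbx⟩ := exists_mem_of_lt_generated y.2 (show x.1 < y.1 from h)
    exact ⟨⟨b, subset_generated hb⟩, (isAtom_generated_iff hB).2 hb, hby, hbx⟩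
  covBy x a y ha hax hy := by
    have ha' := (isAtom_generated_iff hB).1 ha
    have hxy : x ≤ y := hy.1 (by simp)
    have hay : a ≤ y := hy.1 (by simp)
    obtain ⟨z, hz⟩ := hP.exists_join y.1 x.1 a.1 hxy hay
    have hzB := mem_generated_of_isJoinBelow x.2 a.2 hP hz
    have hzy : y ≤ ⟨z, hzB⟩ := hy.2 (y := ⟨z, hzB⟩)
      (by simp [upperBounds, ← Subtype.coe_le_coe, hz.left, hz.right]) hz.le
    have hzy' : z = y.1 := le_antisymm hz.le hzy
    rw [← hP.coe_covBy_coe_generated hB, ← hzy']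
    exact hP.covBy_of_isJoinBelow (hB _ ha') hax hz

theorem rk_coe_generated {B : Set P} (hB : ∀ b ∈ B, IsAtom b) (x : LGPoset.generated B) :
    rk x = rk x.1 :=
  rk_eq_of_covBy (f := fun x : LGPoset.generated B => rk x.1) rk_bot
    (fun _ _ h => hP.rk_of_covBy ((hP.coe_covBy_coe_generated hB).2 h)) x

/-- Local geometricity passes to `P_{≥ a}`, because intervals of geometric lattices are
geometric. -/
theorem restriction (a : P) : HasLocalGeometry (Set.Ici a) where
  exists_join m x y hx hy := by
    obtain ⟨z, hz⟩ := hP.exists_join m.1 x.1 y.1 hx hy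
    exact ⟨⟨z, x.2.trans hz.left⟩, hz.le, hz.left, hz.right, fun w => hz.least w.1⟩
  exists_atom x y h := by
    obtain ⟨b, hb, hby, hbx⟩ := hP.exists_atom x.1 y.1 h
    have hay : a ≤ y.1 := y.2
    have hba : ¬ b ≤ a := fun hba => hbx (hba.trans x.2)
    obtain ⟨c, hc⟩ := hP.exists_join y.1 a b hay hby
    refine ⟨⟨c, hc.left⟩, ?_, hc.le, fun hcx => hbx (hc.right.trans hcx)⟩
    rw [← bot_covBy_iff, ← coe_covBy_coe_iff Set.ordConnected_Ici]
    exact hP.covBy_of_isJoinBelow hb hba hc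
  covBy x c y hc hcx hy := by
    rw [← bot_covBy_iff, ← coe_covBy_coe_iff Set.ordConnected_Ici] at hc
    obtain ⟨b, hb, hba, hj⟩ := hP.exists_atom_isJoinBelow hc
    have hxy : x ≤ y := hy.1 (by simp)
    have hcy : c ≤ y := hy.1 (by simp)
    rw [← coe_covBy_coe_iff Set.ordConnected_Ici]
    have hbx : ¬ b ≤ x.1 := fun hbx => hcx (hP.le_of_isJoinBelow hj hcy hxy x.2 hbx)
    refine hP.covBy x.1 b y.1 hb hbx ⟨?_, fun w hw hwy => ?_⟩
    · rintro s (rfl | rfl)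
      · exact hxy
      · exact hj.right.trans hcy
    · have h1 : x.1 ≤ w := hw (by simp)
      have h2 : b ≤ w := hw (by simp)
      have haw : a ≤ w := le_trans x.2 h1
      have hcw : c.1 ≤ w := hP.le_of_isJoinBelow hj hcy hwy haw h2
      exact hy.2 (y := ⟨w, haw⟩)
        (by simp [upperBounds, ← Subtype.coe_le_coe, h1, hcw]) hwy

theorem rk_coe_restriction {a : P} (x : Set.Ici a) : rk x + rk a = rk x.1 := by
  have h : rk x = rk x.1 - rk a :=
    rk_eq_of_covBy (f := fun x : Set.Ici a => rk x.1 - rk a) (Nat.sub_self _)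
      (fun x y h => by
        have h1 := hP.rk_of_covBy ((coe_covBy_coe_iff Set.ordConnected_Ici).2 h)
        have h2 : rk a ≤ rk x.1 := hP.rk_mono x.2
        omega) x
  have : rk a ≤ rk x.1 := hP.rk_mono x.2
  omega

theorem rk_atom {a : P} (ha : IsAtom a) : rk a = 1 := by
  simpa using hP.rk_of_covBy (bot_covBy_iff.2 ha)

end HasLocalGeometry

end Generated

/-! ### Modular ideals of corank one -/

section Modular

variable {P : Type u} [PartialOrder P] [OrderBot P]

/-- The consequence of the TM-ideal axioms in corank one on which the whole argument rests: every
outer atom `a` has a least upper bound with each `q ∈ Q`, no further element of `Q` lies below it,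
and all elements above `a` are of this form. -/
structure IsModularCorankOne (Q : OrderIdeal P) : Prop where
  exists_join : ∀ a ∈ Q.outerAtoms, ∀ q ∈ Q.carrier, ∃ z, IsLUB {a, q} z ∧
    ∀ p ∈ Q.carrier, p ≤ z → p ≤ q
  exists_eq_join : ∀ a ∈ Q.outerAtoms, ∀ x, a ≤ x → ∃ q ∈ Q.carrier, IsLUB {a, q} x

theorem OrderIdeal.rk_elem (Q : OrderIdeal P) (x : Q.Elem) : rk x = rk x.1 :=
  (rk_coe_of_isLowerSet Q.lower x).symm

/-- The modular law for a modular element `y` of `P_{≤ m}`, stated in `P`: if `q = x ∧ y ≤ z ≤ y`,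
then `y ∧ (x ∨ z) = z`. -/
theorem IsModularElement.le_of_le_join (hP : HasLocalGeometry P) {m y x q z w t : P} (hym : y ≤ m)
    (hmod : IsModularElement (⟨y, hym⟩ : Set.Iic m)) (hx : x ≤ m) (hqy : q ≤ y) (hqx : q ≤ x)
    (hq : ∀ s, s ≤ y → s ≤ x → s ≤ q) (hqz : q ≤ z) (hzy : z ≤ y) (hw : IsJoinBelow m x z w)
    (hty : t ≤ y) (htw : t ≤ w) : t ≤ z := by
  have h := hmod ⟨z, hzy.trans hym⟩ ⟨x, hx⟩ hzy ⟨w, hw.le⟩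
    (mem_joinSet_coe_Iic.2 hw.mem_joinSet) ⟨q, hqx.trans hx⟩
    ⟨by simp [lowerBounds, ← Subtype.coe_le_coe, hqy, hqx], fun s hs _ => by
      simp only [lowerBounds_insert, lowerBounds_singleton, Set.mem_inter_iff, Set.mem_Iic] at hs
      exact hq s.1 hs.1 hs.2⟩
  have hz : (⟨z, hzy.trans hym⟩ : Set.Iic m) ∈
      joinSet {(⟨q, hqx.trans hx⟩ : Set.Iic m), ⟨z, hzy.trans hym⟩} :=
    ⟨by simp [upperBounds, ← Subtype.coe_le_coe, hqz], fun s hs _ => hs (by simp)⟩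
  rw [← h] at hz
  obtain ⟨s, hs⟩ := hP.exists_join m t z (hty.trans hym) (hzy.trans hym)
  have := hz.2 (y := ⟨s, hs.le⟩) (by
    simp only [lowerBounds_insert, lowerBounds_singleton, Set.mem_inter_iff, Set.mem_Iic]
    exact ⟨hs.least y hym hty hzy, hs.least w hw.le htw hw.right⟩) hs.right
  exact hs.left.trans this

variable [Finite P]

/-- A modular element `y` which is a coatom of `P_{≤ m}` meets every `x ≰ y` in a lower cover of
`x`: joining with `x` maps the interval `[q, y]`, where `q = x ∧ y`, strictly monotonically into
`[x, m]`, so the latter has at least the length of the former. -/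
theorem IsModularElement.covBy_of_covBy (hP : HasLocalGeometry P) {m y x q : P} (hym : y ⋖ m)
    (hmod : IsModularElement (⟨y, hym.le⟩ : Set.Iic m)) (hx : x ≤ m) (hxy : ¬ x ≤ y)
    (hqy : q ≤ y) (hqx : q ≤ x) (hq : ∀ s, s ≤ y → s ≤ x → s ≤ q) : q ⋖ x := by
  have key : ∀ z, q ≤ z → z ≤ y → ∀ w, IsJoinBelow m x z w → rk x + rk z ≤ rk w + rk q := by
    intro z
    induction z using WellFoundedLT.induction with
    | ind z ih =>
      intro hqz hzy w hw
      rcases hqz.eq_or_lt with rfl | hlt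
      · have := hP.rk_mono hw.left
        omega
      · obtain ⟨v, hqv, hvz⟩ := exists_le_covBy_of_lt hlt
        have hvy := hvz.le.trans hzy
        obtain ⟨u, hu⟩ := hP.exists_join m x v hx (hvy.trans hym.le)
        have h1 := ih v hvz.lt hqv hvy u hu
        have h2 := hP.rk_of_covBy hvz
        have huw : u < w := by
          refine (hu.least w hw.le hw.left (hvz.le.trans hw.right)).lt_of_ne fun huw => ?_
          subst huw
          exact hvz.lt.not_ge
            (hmod.le_of_le_join hP hym.le hx hqy hqx hq hqv hvy hu hzy hw.right)
        have := hP.rk_lt_of_lt huw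
        omega
  have hw : IsJoinBelow m x y m := by
    obtain ⟨w, hw⟩ := hP.exists_join m x y hx hym.le
    have : w = m := eq_of_covBy_of_lt_of_le hym
      (hw.right.lt_of_ne fun h => hxy (h ▸ hw.left)) hw.le
    exact this ▸ hw
  have h1 := key y hqy le_rfl m hw
  have h2 := hP.rk_of_covBy hym
  exact hP.covBy_of_lt_of_rk (hqx.lt_of_ne fun h => hxy (h ▸ hqy)) (by omega)

theorem OrderIdeal.IsTMIdeal.isModularCorankOne (hP : HasLocalGeometry P) {Q : OrderIdeal P}
    (hQ : Q.IsTMIdeal) (hr : rank Q.Elem + 1 = rank P) : IsModularCorankOne Q := by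
  -- every element above an outer atom lies below some `m` whose ideal meets `Q` in `P_{≤ y}`,
  -- where `y` is a modular coatom
  have setup : ∀ a ∈ Q.outerAtoms, ∀ x, a ≤ x → ∃ (m y : P) (hym : y ⋖ m), x ≤ m ∧
      y ∈ Q.carrier ∧ (∀ p ∈ Q.carrier, p ≤ m → p ≤ y) ∧
      IsModularElement (⟨y, hym.le⟩ : Set.Iic m) := by
    intro a ha x hax
    obtain ⟨m, hxm, hm⟩ := Finite.exists_le_maximal (p := fun _ : P => True) (a := x) trivial
    have hmax : IsMax m := fun w hw => hm.2 trivial hw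
    obtain ⟨y, hym, hyQ, hmod⟩ := hQ.exists_modular m hmax
    have hne : y ≠ m := fun h => ha.2 (Q.lower (hax.trans hxm) (h ▸ hyQ.1))
    have hyr : rk y = rank Q.Elem := by
      have hyM : IsMax (⟨y, hyQ.1⟩ : Q.Elem) := fun w hw => hyQ.2 w.2 hw
      obtain ⟨v, hv⟩ := exists_rk_eq_rank (P := Q.Elem)
      obtain ⟨t, hvt, ht⟩ :=
        Finite.exists_le_maximal (p := fun _ : Q.Elem => True) (a := v) trivial
      have h1 := hQ.pure _ t hyM fun w hw => ht.2 trivial hw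
      have h2 := (hP.of_orderIdeal Q).rk_mono hvt
      have h3 := rk_le_rank t
      have h4 : rk y = rk (⟨y, hyQ.1⟩ : Q.Elem) := rk_coe_of_isLowerSet Q.lower ⟨y, hyQ.1⟩
      omega
    have hcov : y ⋖ m := hP.covBy_of_lt_of_rk (hym.lt_of_ne hne) (by
      rw [hyr, hr]
      exact rk_le_rank m)
    refine ⟨m, y, hcov, hxm, hyQ.1, fun p hp hpm => ?_, hmod⟩
    obtain ⟨s, hs⟩ := hP.exists_join m p y hpm hym
    have hsQ : s ∈ Q.carrier := hQ.joinClosed {p, y}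
      (by simp [Set.insert_subset_iff, hp, hyQ.1]) hs.mem_joinSet
    exact hs.left.trans (hyQ.2 hsQ hs.right)
  have lub : ∀ a ∈ Q.outerAtoms, ∀ q ∈ Q.carrier, ∃ z, IsLUB {a, q} z := by
    intro a ha q hq
    have h := hQ.existsUnique_join q hq a ha
    exact ⟨_, isLUB_of_existsUnique h h.choose_spec.1⟩
  constructor
  · intro a ha q hq
    obtain ⟨z, hz⟩ := lub a ha q hq
    refine ⟨z, hz, fun p hp hpz => ?_⟩
    rw [isLUB_pair_iff] at hz
    obtain ⟨m, y, hym, hzm, hyQ, hy, hmod⟩ := setup a ha z hz.1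
    refine hmod.le_of_le_join hP hym.le (hz.1.trans hzm) bot_le bot_le (fun s hsy hsa => ?_)
      bot_le (hy q hq (hz.2.1.trans hzm)) ⟨hzm, hz.1, hz.2.1, fun w _ => hz.2.2 w⟩
      (hy p hp (hpz.trans hzm)) hpz
    rcases ha.1.le_iff.1 hsa with h | h
    · exact h.le
    · exact absurd (Q.lower (h ▸ hsy) hyQ) ha.2
  · intro a ha x hax
    obtain ⟨m, y, hym, hxm, hyQ, hy, hmod⟩ := setup a ha x hax
    obtain ⟨q, hqx, hqy, hq⟩ := hP.exists_isGLB hxm hym.le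
    have hqQ := Q.lower hqy hyQ
    have hxy : ¬ x ≤ y := fun h => ha.2 (Q.lower (hax.trans h) hyQ)
    have hcov := hmod.covBy_of_covBy hP hym hxm hxy hqy hqx fun s h1 h2 => hq s h2 h1
    obtain ⟨z, hz⟩ := lub a ha q hqQ
    have hz' := isLUB_pair_iff.1 hz
    have : z = x := eq_of_covBy_of_lt_of_le hcov
      (hz'.2.1.lt_of_ne fun h => ha.2 (Q.lower (h ▸ hz'.1) hqQ)) (hz'.2.2 x hax hqx)
    exact ⟨q, hqQ, this ▸ hz⟩

end Modular

/-! ### The Möbius function and the characteristic polynomial -/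

section Mobius

open scoped Classical

theorem sum_extend_smul {S α M : Type*} [Fintype S] [Fintype α] [AddCommGroup M]
    {e : S → α} (he : Function.Injective e) (g : S → ℤ) (F : α → M) :
    ∑ x, Function.extend e g 0 x • F x = ∑ s, g s • F (e s) := by
  symm
  refine Fintype.sum_of_injective e he _ _ (fun x hx => ?_) fun s => ?_
  · rw [Function.extend_apply' _ _ _ fun ⟨s, hs⟩ => hx ⟨s, hs⟩]
    simp
  · rw [he.extend_apply]

variable {P : Type u} [PartialOrder P] [OrderBot P] [Finite P]

theorem sum_mobius [Fintype P] (x : P) :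
    ∑ y, (if y ≤ x then mobius (⊥ : P) y else 0) = if x = ⊥ then 1 else 0 := by
  let _ : LocallyFiniteOrder P := Fintype.toLocallyFiniteOrder
  have h := IncidenceAlgebra.sum_Icc_mu_right (𝕜 := ℤ) (⊥ : P) x
  rw [← Finset.sum_filter]
  have h1 : Finset.univ.filter (· ≤ x) = Finset.Icc ⊥ x := by
    ext y
    simp
  rw [h1]
  simp only [eq_comm (a := (⊥ : P))] at h
  rw [← h]
  refine Finset.sum_congr rfl fun y _ => ?_
  unfold mobius
  congr!

/-- The Möbius function is determined by its defining recursion. -/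
theorem mobius_eq_of_sum [Fintype P] {f : P → ℤ}
    (hf : ∀ x, ∑ y, (if y ≤ x then f y else 0) = if x = ⊥ then 1 else 0) (x : P) :
    mobius ⊥ x = f x := by
  induction x using WellFoundedLT.induction with
  | ind x ih =>
    have h := (sum_mobius x).trans (hf x).symm
    rw [← Finset.add_sum_erase _ _ (Finset.mem_univ x),
      ← Finset.add_sum_erase _ (fun y => if y ≤ x then f y else 0) (Finset.mem_univ x)] at h
    have h2 : ∑ y ∈ Finset.univ.erase x, (if y ≤ x then mobius (⊥ : P) y else 0) =
        ∑ y ∈ Finset.univ.erase x, (if y ≤ x then f y else 0) := by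
      refine Finset.sum_congr rfl fun y hy => ?_
      split_ifs with hyx
      · exact ih y (hyx.lt_of_ne (Finset.ne_of_mem_erase hy))
      · rfl
    rw [h2] at h
    simpa only [le_refl, if_true, add_left_inj] using h

theorem charPoly_eq [Fintype P] :
    charPoly P = ∑ x : P, C (mobius ⊥ x) * X ^ (rank P - rk x) := by
  unfold charPoly
  congr!

@[simp] theorem mobius_bot_bot : mobius (⊥ : P) ⊥ = 1 := by
  let _ := Fintype.ofFinite P
  have h := sum_mobius (⊥ : P)
  simpa [le_bot_iff] using h

theorem mobius_orderIso {P' : Type*} [PartialOrder P'] [OrderBot P'] [Finite P']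
    (e : P ≃o P') (x : P) : mobius (⊥ : P') (e x) = mobius ⊥ x := by
  let _ := Fintype.ofFinite P
  let _ := Fintype.ofFinite P'
  refine (mobius_eq_of_sum (f := fun x => mobius (⊥ : P') (e x)) (fun x => ?_) x).symm
  have h := sum_mobius (e x)
  rw [← e.toEquiv.sum_comp] at h
  simpa using h

theorem charPoly_orderIso {P' : Type*} [PartialOrder P'] [OrderBot P'] [Finite P']
    (e : P ≃o P') : charPoly P' = charPoly P := by
  let _ := Fintype.ofFinite P
  let _ := Fintype.ofFinite P'
  rw [charPoly_eq, charPoly_eq, ← e.toEquiv.sum_comp]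
  refine Finset.sum_congr rfl fun x _ => ?_
  have h1 : mobius (⊥ : P') (e x) = mobius ⊥ x := mobius_orderIso e x
  have h2 : rk (e x) = rk x := rk_orderIso e x
  simp [h1, h2, rank_orderIso e]

theorem charPoly_of_subsingleton [Subsingleton P] : charPoly P = 1 := by
  let _ : Unique P := ⟨⟨⊥⟩, fun x => Subsingleton.elim _ _⟩
  rw [charPoly_eq, Fintype.sum_unique]
  have h1 : (default : P) = ⊥ := rfl
  have h2 : rank P = 0 := by
    obtain ⟨x, hx⟩ := exists_rk_eq_rank (P := P)
    rw [← hx, Subsingleton.elim x ⊥, rk_bot]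
  simp [h1, h2]

theorem rk_pos_of_ne_bot {x : P} (hP : HasLocalGeometry P) (h : x ≠ ⊥) : 0 < rk x := by
  simpa using hP.rk_lt_of_lt (bot_lt_iff_ne_bot.2 h)

theorem charPoly_eq_X_pow_add (hP : HasLocalGeometry P) :
    ∃ p : ℤ[X], p.degree < (rank P : ℕ) ∧ charPoly P = X ^ rank P + p := by
  let _ := Fintype.ofFinite P
  refine ⟨∑ x ∈ Finset.univ.erase (⊥ : P), C (mobius ⊥ x) * X ^ (rank P - rk x), ?_, ?_⟩
  · rw [← Polynomial.mem_degreeLT]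
    refine Submodule.sum_mem _ fun x hx => Polynomial.mem_degreeLT.2 ?_
    have h1 := rk_pos_of_ne_bot hP (Finset.ne_of_mem_erase hx)
    have h2 := rk_le_rank x
    refine (Polynomial.degree_C_mul_X_pow_le _ _).trans_lt ?_
    exact_mod_cast (by omega : rank P - rk x < rank P)
  · rw [charPoly_eq, ← Finset.add_sum_erase _ _ (Finset.mem_univ (⊥ : P))]
    simp

theorem charPoly_monic (hP : HasLocalGeometry P) : (charPoly P).Monic := by
  obtain ⟨p, hp, h⟩ := charPoly_eq_X_pow_add hP
  exact h ▸ monic_X_pow_add hp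

theorem natDegree_charPoly (hP : HasLocalGeometry P) : (charPoly P).natDegree = rank P := by
  obtain ⟨p, hp, h⟩ := charPoly_eq_X_pow_add hP
  rw [h]
  apply natDegree_eq_of_degree_eq_some
  rw [degree_add_eq_left_of_degree_lt] <;> simp [hp]

/-! ### The sign of the Möbius function -/

/-- Weisner's theorem for an atom: the values `μ(⊥, y)` with `y ∨ a = x` sum to zero. The elements
`y ≤ x` with `y ∨ a = x` are `x` and the lower covers of `x` not above `a`. -/
theorem mobius_eq_neg_sum_covBy [Fintype P] (hP : HasLocalGeometry P) {a x : P} (ha : IsAtom a)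
    (hax : a ≤ x) :
    mobius ⊥ x = - ∑ y, if y ⋖ x ∧ ¬ a ≤ y then mobius (⊥ : P) y else 0 := by
  have key : ∀ x, a ≤ x →
      ∑ y, (if y = x ∨ (y ⋖ x ∧ ¬ a ≤ y) then mobius (⊥ : P) y else 0) = 0 := by
    intro x
    induction x using WellFoundedLT.induction with
    | ind x ih =>
      intro hax
      have h0 := sum_mobius x
      have hx0 : x ≠ ⊥ := fun h => ha.1 (le_bot_iff.1 (h ▸ hax))
      rw [if_neg hx0] at h0
      have h1 : ∀ y, (if y ≤ x then mobius (⊥ : P) y else 0) = ∑ z, if z ≤ x ∧ a ≤ z then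
          (if y = z ∨ (y ⋖ z ∧ ¬ a ≤ y) then mobius (⊥ : P) y else 0) else 0 := by
        intro y
        by_cases hyx : y ≤ x
        · obtain ⟨w, hw⟩ := hP.exists_join x y a hyx hax
          rw [Finset.sum_eq_single w]
          · have : y = w ∨ (y ⋖ w ∧ ¬ a ≤ y) := by
              by_cases hay : a ≤ y
              · exact Or.inl (le_antisymm hw.left (hw.least y hyx le_rfl hay))
              · exact Or.inr ⟨hP.covBy_of_isJoinBelow ha hay hw, hay⟩
            rw [if_pos hyx, if_pos ⟨hw.le, hw.right⟩, if_pos this]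
          · intro z _ hzw
            split_ifs with h2 h3
            · exfalso
              apply hzw
              rcases h3 with rfl | ⟨h3, h4⟩
              · exact le_antisymm hw.left (hw.least _ h2.1 le_rfl h2.2)
              · exact (eq_of_covBy_of_lt_of_le h3
                  (hw.left.lt_of_ne fun h => h4 (h ▸ hw.right))
                  (hw.least z h2.1 h3.le h2.2)).symm
            · rfl
            · rfl
          · simp
        · rw [if_neg hyx, Finset.sum_eq_zero]
          intro z _
          split_ifs with h2 h3
          · exfalso
            apply hyx
            rcases h3 with rfl | ⟨h3, h4⟩
            · exact h2.1
            · exact h3.le.trans h2.1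
          · rfl
          · rfl
      rw [Finset.sum_congr rfl fun y _ => h1 y, Finset.sum_comm] at h0
      rw [Finset.sum_eq_single x] at h0
      · simpa [hax] using h0
      · intro z _ hzx
        split_ifs with h2
        · exact ih z (h2.1.lt_of_ne hzx) h2.2
        · simp
      · simp
  have h := key x hax
  rw [← Finset.add_sum_erase _ _ (Finset.mem_univ x)] at h
  rw [← Finset.add_sum_erase _ (fun y => if y ⋖ x ∧ ¬ a ≤ y then mobius (⊥ : P) y else 0)
    (Finset.mem_univ x)]
  have h2 : ∑ y ∈ Finset.univ.erase x,
      (if y = x ∨ (y ⋖ x ∧ ¬ a ≤ y) then mobius (⊥ : P) y else 0) =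
      ∑ y ∈ Finset.univ.erase x, if y ⋖ x ∧ ¬ a ≤ y then mobius (⊥ : P) y else 0 := by
    refine Finset.sum_congr rfl fun y hy => ?_
    simp [Finset.ne_of_mem_erase hy]
  rw [h2] at h
  simp only [true_or, if_true] at h
  simp only [hax, not_true, and_false, if_false]
  linarith

theorem HasLocalGeometry.exists_covBy_not_ge (hP : HasLocalGeometry P) {a x : P} (ha : IsAtom a)
    (hax : a ≤ x) : ∃ y, y ⋖ x ∧ ¬ a ≤ y := by
  obtain ⟨y, -, hy⟩ := Finite.exists_le_maximal (p := fun y => y ≤ x ∧ ¬ a ≤ y) (a := (⊥ : P))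
    ⟨bot_le, fun h => ha.1 (le_bot_iff.1 h)⟩
  obtain ⟨z, hz⟩ := hP.exists_join x y a hy.1.1 hax
  have hyz := hP.covBy_of_isJoinBelow ha hy.1.2 hz
  rcases hz.le.eq_or_lt with rfl | hlt
  · exact ⟨y, hyz, hy.1.2⟩
  · -- an atom `b` outside `y ∨ a` could be added to `y` without reaching `a`
    exfalso
    obtain ⟨b, hb, hbx, hbz⟩ := hP.exists_atom _ _ hlt
    obtain ⟨w, hw⟩ := hP.exists_join x y b hy.1.1 hbx
    have hyw := hP.covBy_of_isJoinBelow hb (fun h => hbz (h.trans hz.left)) hw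
    have haw : ¬ a ≤ w := by
      intro haw
      have : z = w := eq_of_covBy_of_lt_of_le hyw hyz.lt (hz.least w hw.le hw.left haw)
      exact hbz (this ▸ hw.right)
    exact hyw.lt.not_ge (hy.2 ⟨hw.le, haw⟩ hw.left)

/-- Rota's sign theorem. -/
theorem mobius_sign (hP : HasLocalGeometry P) (x : P) : 0 < (-1) ^ rk x * mobius (⊥ : P) x := by
  let _ := Fintype.ofFinite P
  induction x using WellFoundedLT.induction with
  | ind x ih =>
    rcases (bot_le (a := x)).eq_or_lt with rfl | h
    · simp
    · obtain ⟨a, ha, hax, -⟩ := hP.exists_atom _ _ h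
      rw [mobius_eq_neg_sum_covBy hP ha hax, ← Finset.sum_neg_distrib, Finset.mul_sum]
      have hterm : ∀ y, y ⋖ x → ¬ a ≤ y → 0 < (-1) ^ rk x * -mobius (⊥ : P) y := by
        intro y hy _
        have := ih y hy.lt
        rw [hP.rk_of_covBy hy, pow_succ]
        linarith
      obtain ⟨y, hy, hay⟩ := hP.exists_covBy_not_ge ha hax
      refine Finset.sum_pos' (fun y _ => ?_) ⟨y, Finset.mem_univ y, ?_⟩
      · split_ifs with h
        · exact (hterm y h.1 h.2).le
        · simp
      · rw [if_pos ⟨hy, hay⟩]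
        exact hterm y hy hay

/-- Since the signs of the Möbius function alternate with the rank, the characteristic polynomial
has no root in `(-∞, 0]`. -/
theorem pos_of_isRoot_charPoly (hP : HasLocalGeometry P) {d : ℤ} (hd : (charPoly P).IsRoot d) :
    0 < d := by
  let _ := Fintype.ofFinite P
  by_contra hneg
  push Not at hneg
  have h : 0 < ∑ x : P, (-1) ^ rank P * (mobius ⊥ x * d ^ (rank P - rk x)) := by
    have hterm : ∀ x : P, (-1) ^ rank P * (mobius ⊥ x * d ^ (rank P - rk x)) =
        ((-1) ^ rk x * mobius ⊥ x) * (-d) ^ (rank P - rk x) := by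
      intro x
      obtain ⟨k, hk⟩ := Nat.exists_eq_add_of_le (rk_le_rank x)
      rw [hk, Nat.add_sub_cancel_left, pow_add, neg_pow d k]
      ring
    simp only [hterm]
    obtain ⟨x, hx⟩ := exists_rk_eq_rank (P := P)
    refine Finset.sum_pos' (fun y _ => ?_) ⟨x, Finset.mem_univ x, ?_⟩
    · exact mul_nonneg (mobius_sign hP y).le (pow_nonneg (by linarith) _)
    · simpa [hx] using mobius_sign hP x
  rw [← Finset.mul_sum] at h
  have h0 : ∑ x : P, mobius ⊥ x * d ^ (rank P - rk x) = 0 := by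
    have := hd
    rw [IsRoot.def, charPoly_eq, eval_finsetSum] at this
    simpa using this
  simp [h0] at h

end Mobius

/-! ### Decompositions of the characteristic polynomial -/

section Decompositions

open scoped Classical

section Decompose

theorem sum_extend_sub_smul {α S T ι M : Type*} [Fintype α] [Fintype S] [Fintype T] [Fintype ι]
    [AddCommGroup M] {e : S → α} (he : Function.Injective e) {j : ι → T → α}
    (hj : ∀ i, Function.Injective (j i)) (g : S → ℤ) (h : T → ℤ) (F : α → M) :
    ∑ x, (Function.extend e g 0 x - ∑ i, Function.extend (j i) h 0 x) • F x =
      ∑ s, g s • F (e s) - ∑ i, ∑ t, h t • F (j i t) := by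
  simp only [sub_smul, Finset.sum_sub_distrib, Finset.sum_smul, sum_extend_smul he]
  rw [Finset.sum_comm]
  simp only [sum_extend_smul (hj _)]

/-- If every `x` has a greatest element of `S` below it, then the Möbius function of `S` sums to
zero over the elements of `S` below `x`, unless `⊥` is the only one. -/
theorem sum_mobius_coe {P S : Type*} [PartialOrder P] [PartialOrder S] [OrderBot S] [Fintype S]
    {e : S → P} {x : P} {s : S} [Decidable (s = ⊥)] (h : ∀ t, e t ≤ x ↔ t ≤ s) :
    (∑ t, if e t ≤ x then mobius (⊥ : S) t else 0) = if s = ⊥ then 1 else 0 := by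
  simp only [h]
  rw [sum_mobius s]
  congr

variable {P : Type u} [PartialOrder P] [OrderBot P] [Finite P]

/-- To express `μ` on `P` through functions pushed forward along injections into `P`, it suffices
to check the recursion defining `μ`; every sum weighted by `μ` then decomposes accordingly. -/
theorem sum_mobius_smul_eq [Fintype P] {S T ι M : Type*} [Fintype S] [Fintype T] [Fintype ι]
    [AddCommGroup M] {e : S → P} (he : Function.Injective e) {j : ι → T → P}
    (hj : ∀ i, Function.Injective (j i)) (g : S → ℤ) (h : T → ℤ)
    (H : ∀ x, (∑ s, if e s ≤ x then g s else 0) - ∑ i, ∑ t, (if j i t ≤ x then h t else 0) =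
      if x = ⊥ then 1 else 0) (F : P → M) :
    ∑ x : P, mobius ⊥ x • F x = ∑ s, g s • F (e s) - ∑ i, ∑ t, h t • F (j i t) := by
  have hmu : ∀ x, mobius ⊥ x = Function.extend e g 0 x - ∑ i, Function.extend (j i) h 0 x := by
    refine mobius_eq_of_sum fun x => ?_
    rw [← H x]
    have := sum_extend_sub_smul he hj g h (fun y => if y ≤ x then (1 : ℤ) else 0)
    simpa only [smul_eq_mul, mul_ite, mul_one, mul_zero] using this
  simp only [hmu]
  exact sum_extend_sub_smul he hj g h F

theorem charPoly_eq_smul [Fintype P] :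
    charPoly P = ∑ x : P, mobius ⊥ x • (X : ℤ[X]) ^ (rank P - rk x) := by
  simp only [charPoly_eq, zsmul_eq_mul, eq_intCast]

theorem exists_greatest_generated (hP : HasLocalGeometry P) (B : Set P) (x : P) :
    ∃ s : generated B, ∀ t : generated B, t.1 ≤ x ↔ t ≤ s := by
  obtain ⟨s, -, hs⟩ := Finite.exists_le_maximal (p := fun y => y ∈ generated B ∧ y ≤ x)
    (a := (⊥ : P)) ⟨bot_mem_generated B, bot_le⟩
  refine ⟨⟨s, hs.1.1⟩, fun t => ⟨fun ht => ?_, fun ht => le_trans ht hs.1.2⟩⟩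
  obtain ⟨z, hz⟩ := hP.exists_join x s t hs.1.2 ht
  exact hz.right.trans
    (hs.2 ⟨mem_generated_of_isJoinBelow hs.1.1 t.2 hP hz, hz.le⟩ hz.left)

/-- Deletion–restriction, when the restriction has the largest possible rank. The power of the
variable accounts for a drop of the rank in the deletion. -/
theorem charPoly_eq_deletion_sub_restriction (hP : HasLocalGeometry P) {a : P} (ha : IsAtom a)
    (hr : rank (Restriction a) + 1 = rank P) :
    ∃ k : ℕ, charPoly P = X ^ k * charPoly (Deletion a) - charPoly (Restriction a) := by
  let _ := Fintype.ofFinite P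
  let _ : Fintype (Deletion a) := Fintype.ofFinite _
  let _ : Fintype (Restriction a) := Fintype.ofFinite _
  have hB : ∀ b ∈ {b : P | IsAtom b} \ {a}, IsAtom b := fun b hb => hb.1
  have hrk : ∀ s : Deletion a, rk s = rk s.1 := hP.rk_coe_generated hB
  have hdel : rank (Deletion a) ≤ rank P := rank_le fun s => hrk s ▸ rk_le_rank _
  refine ⟨rank P - rank (Deletion a), ?_⟩
  rw [charPoly_eq_smul, sum_mobius_smul_eq (e := (Subtype.val : Deletion a → P))
    Subtype.val_injective (ι := Unit) (j := fun _ => (Subtype.val : Restriction a → P))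
    (fun _ => Subtype.val_injective) (fun s => mobius ⊥ s) (fun t => mobius ⊥ t)]
  · rw [charPoly_eq_smul, charPoly_eq_smul, Finset.mul_sum]
    congr 1
    · refine Finset.sum_congr rfl fun s _ => ?_
      rw [mul_smul_comm, ← pow_add]
      have h1 : rk s ≤ rank (Deletion a) := rk_le_rank s
      have h2 := hrk s
      have h3 : rank P - rk s.1 = (rank P - rank (Deletion a)) + (rank (Deletion a) - rk s) := by
        omega
      rw [h3]
    · rw [Finset.univ_unique, Finset.sum_singleton]
      refine Finset.sum_congr rfl fun t _ => ?_
      have h1 := hP.rk_coe_restriction t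
      rw [hP.rk_atom ha] at h1
      congr 2
      omega
  · intro x
    obtain ⟨s, hs⟩ := exists_greatest_generated hP ({b : P | IsAtom b} \ {a}) x
    rw [sum_mobius_coe hs, Finset.univ_unique, Finset.sum_singleton]
    by_cases hax : a ≤ x
    · have hx0 : x ≠ ⊥ := fun h => ha.1 (le_bot_iff.1 (h ▸ hax))
      rw [sum_mobius_coe (e := (Subtype.val : Restriction a → P)) (x := x) (s := ⟨x, hax⟩)
        fun t => Iff.rfl, if_neg hx0]
      have : s = ⊥ ↔ (⟨x, hax⟩ : Restriction a) = ⊥ := by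
        constructor
        · intro h0
          refine Subtype.ext (le_antisymm ?_ hax)
          refine hP.le_of_atoms_le le_rfl hax fun b hb hbx => ?_
          by_contra hba
          have hb' : b ∈ {b : P | IsAtom b} \ {a} :=
            ⟨hb, fun h => hba (Set.mem_singleton_iff.1 h).le⟩
          have := (hs ⟨b, subset_generated hb'⟩).1 hbx
          rw [h0, le_bot_iff] at this
          exact hb.1 (congrArg Subtype.val this)
        · intro h
          have hxa : x = a := congrArg Subtype.val h
          by_contra h0
          have hlt : ⊥ < s.1 := bot_lt_iff_ne_bot.2 fun h => h0 (Subtype.ext h)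
          obtain ⟨b, hb, hbs, -⟩ := exists_mem_of_lt_generated s.2 hlt
          have hbx : b ≤ a := hxa ▸ hbs.trans ((hs s).2 le_rfl)
          exact hb.2 ((ha.le_iff.1 hbx).resolve_left hb.1.1)
      rw [sub_eq_zero]
      split_ifs <;> first | rfl | tauto
    · rw [Finset.sum_eq_zero fun t _ => if_neg fun h => hax (le_trans t.2 h), sub_zero]
      have : s = ⊥ ↔ x = ⊥ := by
        constructor
        · intro h0
          refine le_bot_iff.1 (hP.le_of_atoms_le le_rfl bot_le fun b hb hbx => ?_)
          have hb' : b ∈ {b : P | IsAtom b} \ {a} :=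
            ⟨hb, fun h => hax ((Set.mem_singleton_iff.1 h) ▸ hbx)⟩
          have := (hs ⟨b, subset_generated hb'⟩).1 hbx
          rw [h0, le_bot_iff] at this
          exact absurd (congrArg Subtype.val this) hb.1
        · rintro rfl
          exact Subtype.ext (le_bot_iff.1 ((hs s).2 le_rfl))
      split_ifs <;> first | rfl | tauto

end Decompose

namespace IsModularCorankOne

variable {P : Type u} [PartialOrder P] [OrderBot P] {Q : OrderIdeal P}
  (hQ : IsModularCorankOne Q)
include hQ

/-- Joining with an outer atom `a` identifies `Q` with `P_{≥ a}`. -/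
theorem exists_joins (a : Q.outerAtoms) : ∃ j : Q.Elem → P,
    (∀ q x, j q ≤ x ↔ a.1 ≤ x ∧ q.1 ≤ x) ∧ (∀ p q, j p ≤ j q ↔ p ≤ q) ∧
      ∀ x, a.1 ≤ x → ∃ q, j q = x := by
  choose j hj hjQ using fun q : Q.Elem => hQ.exists_join a.1 a.2 q.1 q.2
  have h1 : ∀ q x, j q ≤ x ↔ a.1 ≤ x ∧ q.1 ≤ x := fun q x => by
    rw [isLUB_le_iff (hj q)]
    simp [upperBounds]
  have h2 : ∀ q, a.1 ≤ j q ∧ q.1 ≤ j q := fun q => (h1 q _).1 le_rfl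
  refine ⟨j, h1, fun p q => ⟨fun h => ?_, fun h => ?_⟩, fun x hx => ?_⟩
  · exact hjQ q p.1 p.2 ((h2 p).2.trans h)
  · exact (h1 _ _).2 ⟨(h2 q).1, le_trans h (h2 q).2⟩
  · obtain ⟨q, hq, hx⟩ := hQ.exists_eq_join a.1 a.2 x hx
    exact ⟨⟨q, hq⟩, (hj ⟨q, hq⟩).unique hx⟩

theorem nonempty_orderIso_restriction {a : P} (ha : a ∈ Q.outerAtoms) :
    Nonempty (Q.Elem ≃o Set.Ici a) := by
  obtain ⟨j, h1, h2, h3⟩ := hQ.exists_joins ⟨a, ha⟩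
  let f : Q.Elem ↪o Set.Ici a :=
    OrderEmbedding.ofMapLEIff (fun q => ⟨j q, ((h1 q _).1 le_rfl).1⟩) h2
  refine ⟨RelIso.ofSurjective f fun x => ?_⟩
  obtain ⟨q, hq⟩ := h3 x.1 x.2
  exact ⟨q, Subtype.ext hq⟩

/-- The ideal `Q` meets every principal ideal in a principal ideal. -/
theorem exists_greatest (hQo : ∀ x ∉ Q.carrier, ∃ a ∈ Q.outerAtoms, a ≤ x) (x : P) :
    ∃ s : Q.Elem, ∀ t : Q.Elem, t.1 ≤ x ↔ t ≤ s := by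
  by_cases hx : x ∈ Q.carrier
  · exact ⟨⟨x, hx⟩, fun t => Iff.rfl⟩
  · obtain ⟨a, ha, hax⟩ := hQo x hx
    obtain ⟨j, h1, h2, h3⟩ := hQ.exists_joins ⟨a, ha⟩
    obtain ⟨q, rfl⟩ := h3 x hax
    exact ⟨q, fun t => by rw [← h2, h1]; exact ⟨fun h => ⟨hax, h⟩, fun h => h.2⟩⟩

/-- Splitting `P` into `Q` and the copies `a ∨ Q` of `Q`, one for each outer atom `a`: the Möbius
function of `P` is that of `Q` minus the ones transported to the copies. -/
theorem rank_and_charPoly [Finite P] (hP : HasLocalGeometry P)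
    (hQo : ∀ x ∉ Q.carrier, ∃ a ∈ Q.outerAtoms, a ≤ x) (hne : Q.outerAtoms.Nonempty) :
    rank P = rank Q.Elem + 1 ∧
      charPoly P = charPoly Q.Elem * (X - C (Q.outerAtoms.ncard : ℤ)) := by
  let _ := Fintype.ofFinite P
  let _ : Fintype Q.Elem := Fintype.ofFinite _
  let _ : Fintype Q.outerAtoms := Fintype.ofFinite _
  choose j h1 h2 h3 using hQ.exists_joins
  have hinj : ∀ a, Function.Injective (j a) := fun a p q h =>
    le_antisymm ((h2 a _ _).1 h.le) ((h2 a _ _).1 h.ge)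
  have hrkQ : ∀ q : Q.Elem, rk q = rk q.1 := Q.rk_elem
  have hrk : ∀ a q, rk (j a q) = rk q + 1 := by
    intro a q
    rw [hrkQ]
    apply hP.rk_of_covBy
    refine hP.covBy q.1 a.1 _ a.2.1 (fun h => a.2.2 (Q.lower h q.2)) (mem_joinSet_of_isLUB ?_)
    rw [isLUB_pair_iff]
    have := (h1 a q _).1 le_rfl
    exact ⟨this.2, this.1, fun w hw1 hw2 => (h1 a q w).2 ⟨hw2, hw1⟩⟩
  have hrank : rank P = rank Q.Elem + 1 := by
    apply le_antisymm
    · refine rank_le fun x => ?_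
      by_cases hx : x ∈ Q.carrier
      · exact (hrkQ ⟨x, hx⟩ ▸ rk_le_rank (⟨x, hx⟩ : Q.Elem)).trans (Nat.le_succ _)
      · obtain ⟨a, ha, hax⟩ := hQo x hx
        obtain ⟨q, rfl⟩ := h3 ⟨a, ha⟩ x hax
        rw [hrk]
        exact Nat.succ_le_succ (rk_le_rank q)
    · obtain ⟨a, ha⟩ := hne
      obtain ⟨q, hq⟩ := exists_rk_eq_rank (P := Q.Elem)
      rw [← hq, ← hrk ⟨a, ha⟩]
      exact rk_le_rank _
  refine ⟨hrank, ?_⟩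
  rw [charPoly_eq_smul, sum_mobius_smul_eq (e := (Subtype.val : Q.Elem → P))
    Subtype.val_injective hinj (fun s => mobius ⊥ s) (fun t => mobius ⊥ t)]
  · have hA : ∀ q : Q.Elem, rank P - rk q.1 = (rank Q.Elem - rk q) + 1 := fun q => by
      have := hrkQ q
      have := rk_le_rank q
      omega
    have hB : ∀ a q, rank P - rk (j a q) = rank Q.Elem - rk q := fun a q => by
      have := hrk a q
      omega
    simp only [hA, hB, pow_succ, ← smul_mul_assoc, ← Finset.sum_mul, ← charPoly_eq_smul]
    rw [Finset.sum_const, mul_sub, Finset.card_univ, ← Nat.card_eq_fintype_card,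
      Nat.card_coe_set_eq, nsmul_eq_mul, mul_comm (charPoly Q.Elem) (C _)]
    simp
  · intro x
    obtain ⟨s, hs⟩ := hQ.exists_greatest hQo x
    rw [sum_mobius_coe hs]
    have hj : ∀ a, (∑ t, if j a t ≤ x then mobius (⊥ : Q.Elem) t else 0) =
        if a.1 ≤ x then (if s = ⊥ then 1 else 0) else 0 := by
      intro a
      rw [← sum_mobius_coe hs]
      split_ifs with h
      · simp only [h1, h, true_and]
      · simp only [h1, h, false_and, if_false, Finset.sum_const_zero]
    simp only [hj]
    by_cases hs0 : s = ⊥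
    · subst hs0
      by_cases hx : x ∈ Q.carrier
      · have hx0 : x = ⊥ := le_bot_iff.1 ((hs ⟨x, hx⟩).1 le_rfl)
        subst hx0
        have : ∀ a : Q.outerAtoms, ¬ a.1 ≤ ⊥ := fun a h => a.2.1.1 (le_bot_iff.1 h)
        simp [this]
      · have hx0 : x ≠ ⊥ := fun h => hx (h ▸ Q.bot_mem)
        obtain ⟨a, ha, hax⟩ := hQo x hx
        obtain ⟨q, rfl⟩ := h3 ⟨a, ha⟩ x hax
        have hq : q = ⊥ := le_bot_iff.1 ((hs q).1 ((h1 _ q _).1 le_rfl).2)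
        have hja : j ⟨a, ha⟩ q ≤ a := (h1 _ _ _).2 ⟨le_rfl, by
          rw [hq]
          exact bot_le⟩
        rw [Finset.sum_eq_single ⟨a, ha⟩]
        · simp [hax, hx0]
        · intro b _ hb
          rw [if_neg]
          intro hbx
          rcases ha.1.le_iff.1 (hbx.trans hja) with h | h
          · exact b.2.1.1 h
          · exact hb (Subtype.ext h)
        · simp
    · have hx0 : x ≠ ⊥ := by
        rintro rfl
        exact hs0 (Subtype.ext (le_bot_iff.1 ((hs s).2 le_rfl)))
      simp [hs0, hx0]

end IsModularCorankOne

end Decompositions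

/-! ### Invariance under isomorphism -/

section Iso

variable {P P' : Type u} [PartialOrder P] [PartialOrder P']

/-- Restriction of an isomorphism to corresponding subposets. -/
def orderIsoSubtype (e : P ≃o P') {p : P → Prop} {p' : P' → Prop} (h : ∀ x, p x ↔ p' (e x)) :
    {x // p x} ≃o {x // p' x} where
  toEquiv := e.toEquiv.subtypeEquiv h
  map_rel_iff' := e.map_rel_iff

/-- Elements of a subposet, as a subposet of a larger one. -/
def orderIsoSubtypeSubtype {p : P → Prop} {q : P → Prop} (h : ∀ x, p x → q x) :
    {x : {x // q x} // p x.1} ≃o {x // p x} where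
  toFun x := ⟨x.1.1, x.2⟩
  invFun x := ⟨⟨x.1, h _ x.2⟩, x.2⟩
  left_inv _ := rfl
  right_inv _ := rfl
  map_rel_iff' := Iff.rfl

theorem mem_generated_orderIso (e : P ≃o P') {B : Set P} {B' : Set P'}
    (h : ∀ x, x ∈ B ↔ e x ∈ B') (x : P) : x ∈ generated B ↔ e x ∈ generated B' := by
  rw [mem_generated_iff, mem_generated_iff, e.surjective.forall]
  refine forall_congr' fun w => ?_
  rw [e.le_iff_le, e.surjective.forall]
  simp [h]

variable [OrderBot P] [OrderBot P']

theorem IsLocallyGeometric.orderIso [Finite P] [Finite P'] (hP : IsLocallyGeometric P)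
    (e : P ≃o P') : IsLocallyGeometric P' := by
  have hP := hP.hasLocalGeometry
  refine HasLocalGeometry.isLocallyGeometric ⟨fun m x y hx hy => ?_, fun x y h => ?_,
    fun x a y ha hax hy => ?_⟩
  · obtain ⟨z, hz⟩ := hP.exists_join (e.symm m) (e.symm x) (e.symm y) (by simpa) (by simpa)
    exact ⟨e z, e.le_symm_apply.1 hz.le, e.symm_apply_le.1 hz.left, e.symm_apply_le.1 hz.right,
      fun w hw h1 h2 => e.le_symm_apply.1 (hz.least _ (by simpa) (by simpa) (by simpa))⟩
  · obtain ⟨a, ha, hay, hax⟩ := hP.exists_atom (e.symm x) (e.symm y) (by simpa)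
    exact ⟨e a, (e.isAtom_iff a).2 ha, e.le_symm_apply.1 hay, fun h => hax (e.le_symm_apply.2 h)⟩
  · rw [← apply_covBy_apply_iff e.symm]
    refine hP.covBy _ (e.symm a) _ ((e.symm.isAtom_iff a).2 ha) (by simpa)
      ⟨?_, fun w hw hwy => ?_⟩
    · have := hy.1
      simpa [upperBounds] using this
    · refine e.symm_apply_le.2 (hy.2 (y := e w) ?_ (e.le_symm_apply.1 hwy))
      simpa [upperBounds, e.symm_apply_le] using hw

end Iso

/-- The isomorphism between restrictions at corresponding elements. -/
def restrictionIso {P P' : Type u} [PartialOrder P] [PartialOrder P'] (e : P ≃o P') (a : P) :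
    Restriction a ≃o Restriction (e a) :=
  orderIsoSubtype e fun _ => e.le_iff_le.symm

/-- The isomorphism between deletions of corresponding elements. -/
def deletionIso {P P' : Type u} [PartialOrder P] [PartialOrder P'] [OrderBot P] [OrderBot P']
    (e : P ≃o P') (a : P) : Deletion a ≃o Deletion (e a) :=
  orderIsoSubtype e (mem_generated_orderIso e fun x => by simp)

theorem IsInductivePoset.orderIso {P P' : Type u} [PartialOrder P] [OrderBot P] [Finite P]
    [PartialOrder P'] [OrderBot P'] [Finite P'] (h : IsInductivePoset P) (e : P ≃o P') :
    IsInductivePoset P' := by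
  induction h generalizing P' with
  | trivial P h => exact .trivial P' e.symm.toEquiv.subsingleton
  | addition P hP a ha hres hdel hdvd ihr ihd =>
    refine .addition P' (hP.orderIso e) (e a) ((e.isAtom_iff a).2 ha)
      (ihr (restrictionIso e a)) (ihd (deletionIso e a)) ?_
    rwa [charPoly_orderIso (restrictionIso e a), charPoly_orderIso (deletionIso e a)]

theorem IsDivisionalPoset.orderIso {P P' : Type u} [PartialOrder P] [OrderBot P] [Finite P]
    [PartialOrder P'] [OrderBot P'] [Finite P'] (h : IsDivisionalPoset P) (e : P ≃o P') :
    IsDivisionalPoset P' := by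
  induction h generalizing P' with
  | trivial P h => exact .trivial P' e.symm.toEquiv.subsingleton
  | division P hP a ha hres hdvd ih =>
    refine .division P' (hP.orderIso e) (e a) ((e.isAtom_iff a).2 ha) (ih (restrictionIso e a)) ?_
    rwa [charPoly_orderIso (restrictionIso e a), charPoly_orderIso e]

/-! ### Factorability of pure inductive and divisional posets -/

section Factorable

variable {P : Type u} [PartialOrder P] [OrderBot P] [Finite P]

theorem IsPure.rk_eq_rank (hP : HasLocalGeometry P) (h : IsPure P) {x : P} (hx : IsMax x) :
    rk x = rank P := by
  obtain ⟨y, hy⟩ := exists_rk_eq_rank (P := P)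
  obtain ⟨m, hym, hm⟩ := Finite.exists_le_maximal (p := fun _ : P => True) (a := y) trivial
  have h1 := h x m hx fun w hw => hm.2 trivial hw
  have h2 := hP.rk_mono hym
  have h3 := rk_le_rank m
  omega

theorem IsPure.restriction (hP : HasLocalGeometry P) (h : IsPure P) (a : P) :
    IsPure (Restriction a) := by
  intro x y hx hy
  have hmax : ∀ {x : Restriction a}, IsMax x → IsMax x.1 := fun {x} hx w hw =>
    hx (b := ⟨w, le_trans x.2 hw⟩) hw
  have h1 := hP.rk_coe_restriction x
  have h2 := hP.rk_coe_restriction y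
  have h3 := h _ _ (hmax hx) (hmax hy)
  omega

theorem IsPure.rank_restriction (hP : HasLocalGeometry P) (h : IsPure P) {a : P} (ha : IsAtom a) :
    rank (Restriction a) + 1 = rank P := by
  obtain ⟨m, ham, hm⟩ := Finite.exists_le_maximal (p := fun _ : P => True) (a := a) trivial
  have hmr := h.rk_eq_rank hP (x := m) fun w hw => hm.2 trivial hw
  have h1 := hP.rk_coe_restriction (⟨m, ham⟩ : Restriction a)
  have h2 : rk (⟨m, ham⟩ : Restriction a) ≤ rank (Restriction a) := rk_le_rank _
  have h3 : rank (Restriction a) ≤ rank P - 1 := rank_le fun x => by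
    have := hP.rk_coe_restriction x
    have := rk_le_rank x.1
    have := hP.rk_atom ha
    omega
  have := hP.rk_atom ha
  simp only at h1
  omega

theorem IsDivisionalPoset.isFactorable (h : IsDivisionalPoset P) (hg : HasLocalGeometry P)
    (hp : IsPure P) : IsFactorable P := by
  induction h with
  | trivial P h =>
    intro z hz
    simp [charPoly_of_subsingleton] at hz
  | division P hP a ha hres hdvd ih =>
    have hg' : HasLocalGeometry (Restriction a) := hg.restriction a
    have ih := ih hg' (hp.restriction hg a)
    obtain ⟨q, hq⟩ := hdvd
    -- by purity the quotient is monic of degree one, so it contributes a single integral root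
    have hr := hp.rank_restriction hg ha
    have hqm : q.Monic := (charPoly_monic hg').of_mul_monic_left (hq ▸ charPoly_monic hg)
    have hdeg : q.natDegree = 1 := by
      have := natDegree_charPoly hg
      rw [hq, (charPoly_monic hg').natDegree_mul hqm, natDegree_charPoly hg'] at this
      omega
    have hqX : q = X + C (q.coeff 0) := hqm.eq_X_add_C hdeg
    have hroot : (charPoly P).IsRoot (-q.coeff 0) := by
      rw [hq, hqX]
      simp
    have hpos := pos_of_isRoot_charPoly hg hroot
    intro z hz
    rw [mem_aroots, hq, map_mul, mul_eq_zero] at hz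
    rcases hz.2 with h | h
    · exact ih z (mem_aroots.2 ⟨(charPoly_monic hg').ne_zero, h⟩)
    · obtain ⟨d, hd⟩ := Int.eq_ofNat_of_zero_le hpos.le
      refine ⟨d, by omega, ?_⟩
      rw [hqX] at h
      rw [map_add, aeval_X, aeval_C, algebraMap_int_eq, eq_intCast] at h
      have h' : z = ((-q.coeff 0 : ℤ) : ℂ) := by
        push_cast
        exact eq_neg_of_add_eq_zero_left h
      rw [h', hd]
      simp

/-- For pure posets the rank of the restriction does not drop by more than one, so the
deletion–restriction formula turns the divisibility required of inductive posets into the one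
required of divisional posets. -/
theorem IsInductivePoset.isDivisionalPoset (h : IsInductivePoset P) (hp : IsPure P) :
    IsDivisionalPoset P := by
  induction h with
  | trivial P h => exact .trivial P h
  | addition P hP a ha hres hdel hdvd ihr ihd =>
    have hg := hP.hasLocalGeometry
    refine .division P hP a ha (ihr (hp.restriction hg a)) ?_
    obtain ⟨k, hk⟩ := charPoly_eq_deletion_sub_restriction hg ha (hp.rank_restriction hg ha)
    rw [hk]
    exact dvd_sub (hdvd.mul_left _) dvd_rfl

end Factorable

/-! ### Adding the outer atoms of a modular ideal -/

section Extension

variable {P : Type u} [PartialOrder P] [OrderBot P] {Q : OrderIdeal P}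

/-- If every element outside `Q` lies above an outer atom, then `Q` can only lack outer atoms by being
all of `P`. -/
theorem nonempty_orderIso_of_outerAtoms_eq_empty
    (hQo : ∀ x ∉ Q.carrier, ∃ a ∈ Q.outerAtoms, a ≤ x) (h : Q.outerAtoms = ∅) :
    Nonempty (Q.Elem ≃o P) := by
  have huniv : ∀ x, x ∈ Q.carrier := fun x => by
    by_contra hx
    obtain ⟨a, ha, -⟩ := hQo x hx
    simp [h] at ha
  exact ⟨{ toFun := Subtype.val, invFun := fun x => ⟨x, huniv x⟩, left_inv := fun _ => rfl,
           right_inv := fun _ => rfl, map_rel_iff' := Iff.rfl }⟩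

/-- The ideal `Q`, regarded as an ideal of the deletion `P ∖ a`. -/
def OrderIdeal.ofDeletion (Q : OrderIdeal P) (a : P) : OrderIdeal (Deletion a) where
  carrier := {x | x.1 ∈ Q.carrier}
  lower _ _ h hx := Q.lower h hx
  bot_mem := Q.bot_mem

theorem OrderIdeal.exists_mem_outerAtoms [Finite P] (hP : HasLocalGeometry P)
    (hQ : ∀ T ⊆ Q.carrier, joinSet T ⊆ Q.carrier) :
    ∀ x ∉ Q.carrier, ∃ a ∈ Q.outerAtoms, a ≤ x := by
  intro x hx
  by_contra hcon
  push Not at hcon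
  refine hx (hQ {a | IsAtom a ∧ a ≤ x} (fun a ha => ?_) ⟨fun a ha => ha.2, fun w hw hwx => ?_⟩)
  · by_contra haQ
    exact hcon a ⟨ha.1, haQ⟩ ha.2
  · exact hP.le_of_atoms_le le_rfl hwx fun a ha hax => hw ⟨ha, hax⟩

theorem OrderIdeal.mem_outerAtoms_ofDeletion {a : P} {b : Deletion a} :
    b ∈ (Q.ofDeletion a).outerAtoms ↔ b.1 ∈ Q.outerAtoms ∧ b.1 ≠ a := by
  have h : IsAtom b ↔ b.1 ∈ {b : P | IsAtom b} \ {a} := isAtom_generated_iff fun b hb => hb.1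
  simp only [OrderIdeal.outerAtoms, Set.mem_ofPred_eq, h, Set.mem_sdiff, Set.mem_singleton_iff]
  exact ⟨fun h => ⟨⟨h.1.1, h.2⟩, h.1.2⟩, fun h => ⟨⟨h.1.1, h.2⟩, h.1.2⟩⟩

variable [Finite P]

theorem OrderIdeal.ncard_outerAtoms_ofDeletion {a : P} (ha : a ∈ Q.outerAtoms) :
    (Q.ofDeletion a).outerAtoms.ncard + 1 = Q.outerAtoms.ncard := by
  have h : Subtype.val '' (Q.ofDeletion a).outerAtoms = Q.outerAtoms \ {a} := by
    ext x
    constructor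
    · rintro ⟨b, hb, rfl⟩
      exact OrderIdeal.mem_outerAtoms_ofDeletion.1 hb
    · rintro ⟨hx, hxa⟩
      exact ⟨⟨x, subset_generated ⟨hx.1, hxa⟩⟩, OrderIdeal.mem_outerAtoms_ofDeletion.2 ⟨hx, hxa⟩,
        rfl⟩
  rw [← Set.ncard_image_of_injective _ Subtype.val_injective, h,
    Set.ncard_sdiff_singleton_add_one ha]

/-- The structure of a modular ideal of corank one survives the deletion of an outer atom, although
the number of outer atoms decreases. -/
theorem IsModularCorankOne.ofDeletion (hP : HasLocalGeometry P) (hQ : IsModularCorankOne Q)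
    (hQo : ∀ x ∉ Q.carrier, ∃ a ∈ Q.outerAtoms, a ≤ x) {a : P} (ha : a ∈ Q.outerAtoms) :
    (∀ q ∈ Q.carrier, q ∈ generated ({b : P | IsAtom b} \ {a})) ∧
    IsModularCorankOne (Q.ofDeletion a) ∧
    ∀ x ∉ (Q.ofDeletion a).carrier, ∃ b ∈ (Q.ofDeletion a).outerAtoms, b ≤ x := by
  have hsub : ∀ q ∈ Q.carrier, q ∈ generated ({b : P | IsAtom b} \ {a}) := fun q hq =>
    mem_generated_of_atoms_mem hP fun b hb hbq =>
      ⟨hb, fun h => ha.2 ((Set.mem_singleton_iff.1 h) ▸ Q.lower hbq hq)⟩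
  refine ⟨hsub, ⟨fun b hb q hq => ?_, fun b hb x hbx => ?_⟩, fun x hx => ?_⟩
  · obtain ⟨hb1, hb2⟩ := OrderIdeal.mem_outerAtoms_ofDeletion.1 hb
    obtain ⟨z, hz, hzQ⟩ := hQ.exists_join b.1 hb1 q.1 hq
    rw [isLUB_pair_iff] at hz
    have hzB := mem_generated_of_isJoinBelow b.2 q.2 hP
      (z := z) (m := z) ⟨le_rfl, hz.1, hz.2.1, fun w _ => hz.2.2 w⟩
    exact ⟨⟨z, hzB⟩, isLUB_pair_iff.2 ⟨hz.1, hz.2.1, fun w => hz.2.2 w.1⟩,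
      fun p hp hpz => hzQ p.1 hp hpz⟩
  · obtain ⟨hb1, hb2⟩ := OrderIdeal.mem_outerAtoms_ofDeletion.1 hb
    obtain ⟨q, hq, hx⟩ := hQ.exists_eq_join b.1 hb1 x.1 hbx
    rw [isLUB_pair_iff] at hx
    exact ⟨⟨q, hsub q hq⟩, hq, isLUB_pair_iff.2 ⟨hx.1, hx.2.1, fun w => hx.2.2 w.1⟩⟩
  · by_contra hcon
    push Not at hcon
    -- then all generators below `x` lie below its largest element `q` in `Q`, so `x = q`
    obtain ⟨q, hq⟩ := hQ.exists_greatest hQo x.1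
    have hqx : q.1 = x.1 := by
      refine mem_generated_iff.1 x.2 q.1 ((hq q).2 le_rfl) fun b hb hbx => ?_
      have hbQ : b ∈ Q.carrier := by
        by_contra hbQ
        exact hcon ⟨b, subset_generated hb⟩
          (OrderIdeal.mem_outerAtoms_ofDeletion.2 ⟨⟨hb.1, hbQ⟩, hb.2⟩) hbx
      exact (hq ⟨b, hbQ⟩).1 hbx
    exact hx (show x.1 ∈ Q.carrier from hqx ▸ q.2)

theorem IsModularCorankOne.charPoly_dvd (hP : HasLocalGeometry P) (hQ : IsModularCorankOne Q)
    (hQo : ∀ x ∉ Q.carrier, ∃ a ∈ Q.outerAtoms, a ≤ x) : charPoly Q.Elem ∣ charPoly P := by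
  rcases Q.outerAtoms.eq_empty_or_nonempty with h | h
  · obtain ⟨e⟩ := nonempty_orderIso_of_outerAtoms_eq_empty hQo h
    rw [charPoly_orderIso e]
  · exact ⟨_, (hQ.rank_and_charPoly hP hQo h).2⟩

/-- The outer atoms can be added to `Q` one at a time, each step having restriction isomorphic to
`Q`. -/
theorem IsModularCorankOne.isInductivePoset (hP : HasLocalGeometry P) (hQ : IsModularCorankOne Q)
    (hQo : ∀ x ∉ Q.carrier, ∃ a ∈ Q.outerAtoms, a ≤ x) (h : IsInductivePoset Q.Elem) :
    IsInductivePoset P := by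
  obtain ⟨n, hn⟩ : ∃ n, Q.outerAtoms.ncard = n := ⟨_, rfl⟩
  induction n generalizing P with
  | zero =>
    obtain ⟨e⟩ := nonempty_orderIso_of_outerAtoms_eq_empty hQo
      ((Set.ncard_eq_zero (Set.toFinite _)).1 hn)
    exact h.orderIso e
  | succ n ih =>
    obtain ⟨a, ha⟩ : Q.outerAtoms.Nonempty := by
      rw [← Set.ncard_pos (Set.toFinite _)]
      omega
    have hB : ∀ b ∈ {b : P | IsAtom b} \ {a}, IsAtom b := fun b hb => hb.1
    have hP' : HasLocalGeometry (Deletion a) := hP.generated hB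
    obtain ⟨hsub, hQ', hQo'⟩ := hQ.ofDeletion hP hQo ha
    have e : (Q.ofDeletion a).Elem ≃o Q.Elem :=
      orderIsoSubtypeSubtype (p := (· ∈ Q.carrier)) hsub
    obtain ⟨f⟩ := hQ.nonempty_orderIso_restriction ha
    refine .addition P hP.isLocallyGeometric a ha.1 (h.orderIso f)
      (ih hP' hQ' hQo' (h.orderIso e.symm) ?_) ?_
    · have := Q.ncard_outerAtoms_ofDeletion ha
      omega
    · have := hQ'.charPoly_dvd hP' hQo'
      rwa [charPoly_orderIso e.symm, ← charPoly_orderIso f] at this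

theorem IsModularCorankOne.isDivisionalPoset (hP : HasLocalGeometry P) (hQ : IsModularCorankOne Q)
    (hQo : ∀ x ∉ Q.carrier, ∃ a ∈ Q.outerAtoms, a ≤ x) (h : IsDivisionalPoset Q.Elem) :
    IsDivisionalPoset P := by
  rcases Q.outerAtoms.eq_empty_or_nonempty with h0 | ⟨a, ha⟩
  · obtain ⟨e⟩ := nonempty_orderIso_of_outerAtoms_eq_empty hQo h0
    exact h.orderIso e
  · obtain ⟨f⟩ := hQ.nonempty_orderIso_restriction ha
    refine .division P hP.isLocallyGeometric a ha.1 (h.orderIso f) ?_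
    have := hQ.charPoly_dvd hP hQo
    rwa [← charPoly_orderIso f] at this

theorem IsModularCorankOne.factorable_and_exponents (hP : HasLocalGeometry P)
    (hQ : IsModularCorankOne Q) (hQo : ∀ x ∉ Q.carrier, ∃ a ∈ Q.outerAtoms, a ≤ x)
    (hne : Q.outerAtoms.Nonempty) (hp : IsPure Q.Elem) (h : IsDivisionalPoset Q.Elem) :
    IsFactorable Q.Elem ∧ IsFactorable P ∧
      exponents P = exponents Q.Elem + {(Q.outerAtoms.ncard : ℤ)} := by
  have hQg := hP.of_orderIdeal Q
  have hf := h.isFactorable hQg hp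
  have hchar := (hQ.rank_and_charPoly hP hQo hne).2
  have hX : (X - C (Q.outerAtoms.ncard : ℤ)) ≠ 0 := X_sub_C_ne_zero _
  have h0 : charPoly Q.Elem * (X - C (Q.outerAtoms.ncard : ℤ)) ≠ 0 :=
    mul_ne_zero (charPoly_monic hQg).ne_zero hX
  refine ⟨hf, fun z hz => ?_, ?_⟩
  · rw [hchar, mem_aroots, map_mul, mul_eq_zero] at hz
    rcases hz.2 with h | h
    · exact hf z (mem_aroots.2 ⟨(charPoly_monic hQg).ne_zero, h⟩)
    · refine ⟨Q.outerAtoms.ncard, (Set.ncard_pos (Set.toFinite _)).2 hne, ?_⟩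
      simpa [sub_eq_zero] using h
  · rw [exponents, exponents, hchar, roots_mul h0, roots_X_sub_C]

end Extension

/-! ### TM-ideals and strictly supersolvable posets -/

section Supersolvable

variable {P : Type u} [PartialOrder P] [OrderBot P] [Finite P]

theorem OrderIdeal.IsTMIdeal.isInductivePoset (hP : HasLocalGeometry P) {Q : OrderIdeal P}
    (hQ : Q.IsTMIdeal) (hr : rank Q.Elem + 1 = rank P) (h : IsInductivePoset Q.Elem) :
    IsInductivePoset P :=
  (hQ.isModularCorankOne hP hr).isInductivePoset hP (Q.exists_mem_outerAtoms hP hQ.joinClosed) h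

theorem IsStrictlySupersolvable.isInductivePoset (h : IsStrictlySupersolvable P) :
    IsInductivePoset P := by
  obtain ⟨hP, r, Q, h0, hr, hstep, hrank⟩ := h
  have hP := hP.hasLocalGeometry
  have key : ∀ i ≤ r, IsInductivePoset (Q i).Elem := by
    intro i
    induction i with
    | zero =>
      refine fun _ => .trivial _ ⟨fun x y => ?_⟩
      have hx : x.1 ∈ ({⊥} : Set P) := h0 ▸ x.2
      have hy : y.1 ∈ ({⊥} : Set P) := h0 ▸ y.2
      exact Subtype.ext (hx.trans hy.symm)
    | succ i ih =>
      intro hi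
      obtain ⟨hlt, hTM⟩ := hstep i hi
      have e : ((Q i).within (Q (i + 1))).Elem ≃o (Q i).Elem :=
        orderIsoSubtypeSubtype (p := (· ∈ (Q i).carrier)) fun x hx => hlt.subset hx
      refine hTM.isInductivePoset (hP.of_orderIdeal _) ?_ ((ih (by omega)).orderIso e.symm)
      rw [rank_orderIso e.symm, hrank i (by omega), hrank (i + 1) hi]
  obtain ⟨e⟩ := nonempty_orderIso_of_outerAtoms_eq_empty (Q := Q r)
    (fun x hx => absurd (hr ▸ Set.mem_univ x) hx) (by simp [OrderIdeal.outerAtoms, hr])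
  exact (key r le_rfl).orderIso e

end Supersolvable

end LGPoset

end

theorem theorem1p3 (P : Type*) [PartialOrder P] [OrderBot P] [Finite P] :
    (LGPoset.IsStrictlySupersolvable P → LGPoset.IsInductivePoset P) ∧
    (LGPoset.IsLocallyGeometric P →
      ∀ Q : LGPoset.OrderIdeal P, Q.IsTMIdeal →
        LGPoset.rank Q.Elem + 1 = LGPoset.rank P →
        (∀ a ∈ Q.outerAtoms, Nonempty (Q.Elem ≃o Set.Ici a)) ∧
        (LGPoset.IsInductivePoset Q.Elem →
          LGPoset.IsInductivePoset P ∧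
          LGPoset.IsFactorable Q.Elem ∧ LGPoset.IsFactorable P ∧
          LGPoset.exponents P = LGPoset.exponents Q.Elem + {(Q.outerAtoms.ncard : ℤ)}) ∧
        (LGPoset.IsDivisionalPoset Q.Elem →
          LGPoset.IsDivisionalPoset P ∧
          LGPoset.IsFactorable Q.Elem ∧ LGPoset.IsFactorable P ∧
          LGPoset.exponents P = LGPoset.exponents Q.Elem + {(Q.outerAtoms.ncard : ℤ)})) := by
  refine ⟨fun h => h.isInductivePoset, fun hP Q hQ hr => ?_⟩
  have hP := hP.hasLocalGeometry
  have hM := hQ.isModularCorankOne hP hr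
  have hQo := Q.exists_mem_outerAtoms hP hQ.joinClosed
  have hne : Q.outerAtoms.Nonempty := by
    -- otherwise `Q` is all of `P`, against the assumption on the ranks
    by_contra hne
    obtain ⟨e⟩ := LGPoset.nonempty_orderIso_of_outerAtoms_eq_empty hQo
      (Set.not_nonempty_iff_eq_empty.1 hne)
    have := LGPoset.rank_orderIso e
    omega
  refine ⟨fun a ha => hM.nonempty_orderIso_restriction ha, fun h => ?_, fun h => ?_⟩
  · exact ⟨hM.isInductivePoset hP hQo h,
      hM.factorable_and_exponents hP hQo hne hQ.pure (h.isDivisionalPoset hQ.pure)⟩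
  · exact ⟨hM.isDivisionalPoset hP hQo h, hM.factorable_and_exponents hP hQo hne hQ.pure h⟩
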